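/- Let $M$ be a free abelian group of rank $n\ge 1$, let $N=\operatorname{Hom}(M,\mathbb Z)$ be its dual with pairing $\langle\cdot,\cdot\rangle$, and let $\sigma\subset N\otimes\mathbb R$ be a strongly convex rational polyhedral cone of maximal dimension $n$. Put $R_\sigma=\sigma^\vee\cap M$, and let $X=\operatorname{Spec}\mathbb C[R_\sigma]$ be the corresponding affine toric variety, of dimension $n$. For a nonzero $a\in\sigma\cap N$ let $\operatorname{val}_a$ be the toric valuation of $\mathbb C(X)$ given on nonzero elements of $\mathbb C[R_\sigma]$ by $\operatorname{val}_a\big(\sum_m c_m\chi^m\big)=\min\{\langle m,a\rangle : c_m\ne 0\}$, and let $q(a)=\max\{k\in\mathbb N : a\in kN\}$. For a prime divisor $E$ on a smooth variety $Y$ with a birational morphism $f\colon Y\to X$ (for instance a resolution of singularities of $X$ that factors through the Nash blowup), let $\operatorname{ord}_E(\widehat K_{Y/X})$ be the integer $k\ge 0$ such that, at the generic point of $E$, the image of the canonical homomorphism $df\colon f^*\wedge^n\Omega_X\to\wedge^n\Omega_Y$ is $\mathcal O_Y(-kE)\cdot\wedge^n\Omega_Y$. If a valuation $v$ of $\mathbb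 C(X)$ has the form $v=q\cdot\operatorname{ord}_E$ for such an $E$ and a positive integer $q$, then the Mather discrepancy of $X$ along $v$ is $\widehat k_v(X)=q\cdot\operatorname{ord}_E(\widehat K_{Y/X})$. Then $\operatorname{val}_a$ is of this form, $\widehat k_{\operatorname{val}_a}(X)$ does not depend on the choice of $Y$, $E$ and $q$, and $$\widehat k_{\operatorname{val}_a}(X)=\min_{\{x_1,\dots,x_n\}}\Big(\sum_{i=1}^n\langle x_i,a\rangle-q(a)\Big),$$ where the minimum is taken over the linearly independent subsets $\{x_1,\dots,x_n\}\subset R_\sigma$ of cardinality $n$. -/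

import Mathlib

open AlgebraicGeometry CategoryTheory TensorProduct

universe u

noncomputable section

namespace ToricMather

/-! ### Smooth birational models of an affine variety -/

/-- For a morphism `f : Y ⟶ Spec A` and a point `y` of `Y`, the pull-back homomorphism
`A → 𝒪_{Y,y}`. -/
def pullbackHom {A : Type u} [CommRing A] {Y : Scheme.{u}}
    (f : Y ⟶ Spec (CommRingCat.of A)) (y : Y) : A →+* Y.presheaf.stalk y :=
  ((Scheme.ΓSpecIso (CommRingCat.of A)).inv ≫ f.appTop ≫
    Y.presheaf.germ ⊤ y trivial).hom

/-- A birational morphism `f : Y ⟶ X = Spec A`, separated and of finite type, with `Y` integral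
and nonsingular. Birationality: `f` identifies the fraction field of `A` with the function
field of `Y`. The morphism is not required to be proper, so this class contains all resolutions of
singularities of `X` (in particular those that factor through the Nash blowup of `X`) and all of
their nonempty open subschemes. -/
structure SmoothModel (A : Type u) [CommRing A] [IsDomain A] where
  /-- the source of the birational morphism -/
  Y : Scheme.{u}
  /-- the birational morphism -/
  f : Y ⟶ Spec (CommRingCat.of A)
  isIntegral : IsIntegral Y
  isLocallyNoetherian : IsLocallyNoetherian Y
  isSeparated : IsSeparated f
  quasiCompact : QuasiCompact f
  locallyOfFiniteType : LocallyOfFiniteType f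
  nonsingular : ∀ y : Y, IsRegularLocalRing (Y.presheaf.stalk y)
  birational :
    letI := (pullbackHom f (genericPoint Y)).toAlgebra
    IsFractionRing A Y.functionField

attribute [instance] SmoothModel.isIntegral SmoothModel.isLocallyNoetherian

/-- The isomorphism of function fields `h ↦ h ∘ f` from `Frac A` to the function field of `Y`. -/
def SmoothModel.pullbackField {A : Type u} [CommRing A] [IsDomain A] (W : SmoothModel A) :
    FractionRing A →+* W.Y.functionField :=
  letI := (pullbackHom W.f (genericPoint W.Y)).toAlgebra
  haveI : IsFractionRing A W.Y.functionField := W.birational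
  (IsLocalization.algEquiv (nonZeroDivisors A) (FractionRing A) W.Y.functionField : _ →+* _)

/-- `v = q · ord_E`, where `E` is the prime divisor on `Y` with generic point `y`. -/
def SmoothModel.Represents {A : Type u} [CommRing A] [IsDomain A] (W : SmoothModel A)
    (v : AddValuation (FractionRing A) (WithTop ℤ)) (y : W.Y) (q : ℕ) : Prop :=
  Order.coheight y = 1 ∧ 0 < q ∧
    ∀ h : FractionRing A, h ≠ 0 →
      v h = (((q : ℤ) * Scheme.ord (W.pullbackField h) y : ℤ) : WithTop ℤ)

/-! ### The Mather discrepancy -/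

/-- For a homomorphism of `ℂ`-algebras `A → O`, the image of the canonical homomorphism
`df : O ⊗ ⋀ⁿ Ω_{A/ℂ} = ⋀ⁿ (O ⊗ Ω_{A/ℂ}) → ⋀ⁿ Ω_{O/ℂ}`. -/
def imageOfForms (n : ℕ) (A O : Type u) [CommRing A] [CommRing O] [Algebra ℂ A] [Algebra ℂ O]
    [Algebra A O] [IsScalarTower ℂ A O] :
    Submodule O (⋀[O]^n (KaehlerDifferential ℂ O)) :=
  LinearMap.range (exteriorPower.map n (KaehlerDifferential.mapBaseChange ℂ A O))

/-- Let `n = dim X`. The relative Mather canonical divisor `K̂_{Y/X}` is the divisor determined by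
the image of `df`, i.e. by `df(f^* ⋀ⁿ Ω_X) = 𝒪_Y(-K̂_{Y/X}) · ⋀ⁿ Ω_Y`. Its order along the prime
divisor `E` with generic point `y` is the number `k` for which this image equals
`𝔪^k · ⋀ⁿ Ω_Y` at `y`, where `𝔪` is the maximal ideal of the discrete valuation ring
`𝒪_{Y,y}`. -/
def SmoothModel.OrdMatherEq {A : Type u} [CommRing A] [IsDomain A] [Algebra ℂ A] (n : ℕ)
    (W : SmoothModel A) (y : W.Y) (k : ℕ) : Prop :=
  letI : Algebra A (W.Y.presheaf.stalk y) := (pullbackHom W.f y).toAlgebra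
  letI : Algebra ℂ (W.Y.presheaf.stalk y) :=
    ((pullbackHom W.f y).comp (algebraMap ℂ A)).toAlgebra
  haveI : IsScalarTower ℂ A (W.Y.presheaf.stalk y) := .of_algebraMap_eq' rfl
  imageOfForms n A (W.Y.presheaf.stalk y) =
    IsLocalRing.maximalIdeal (W.Y.presheaf.stalk y) ^ k •
      (⊤ : Submodule (W.Y.presheaf.stalk y)
        (⋀[W.Y.presheaf.stalk y]^n (KaehlerDifferential ℂ (W.Y.presheaf.stalk y))))

/-- `v` is a divisorial valuation over the `n`-dimensional complex variety `X = Spec A`, and its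
Mather discrepancy `k̂_v(X)` is `d`: there are `f : Y ⟶ X`, a prime divisor `E` on `Y` and `q > 0`
with `v = q · ord_E`, and for every such choice `q · ord_E(K̂_{Y/X}) = d`. -/
def IsMatherDiscrepancy (A : Type u) [CommRing A] [IsDomain A] [Algebra ℂ A] (n : ℕ)
    (v : AddValuation (FractionRing A) (WithTop ℤ)) (d : ℤ) : Prop :=
  (∃ (W : SmoothModel A) (y : W.Y) (q : ℕ), W.Represents v y q) ∧
  ∀ (W : SmoothModel A) (y : W.Y) (q : ℕ), W.Represents v y q →
    (∃ k : ℕ, W.OrdMatherEq n y k) ∧ ∀ k : ℕ, W.OrdMatherEq n y k → (q : ℤ) * k = d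

/-! ### Cones and affine toric varieties -/

section Toric

variable {M : Type u} [AddCommGroup M]

/-- The real extension `N_ℝ = N ⊗ ℝ` of the dual lattice `N` of `M`. -/
abbrev DualSpace (M : Type u) [AddCommGroup M] : Type u := ℝ ⊗[ℤ] Module.Dual ℤ M

/-- The pairing `⟨m, ·⟩ : N_ℝ → ℝ`. -/
def realPairing (m : M) : DualSpace M →ₗ[ℝ] ℝ :=
  Module.Dual.baseChange ℝ (Module.Dual.eval ℤ M m)

/-- A rational polyhedral cone: generated by finitely many elements of `N`. -/
def IsRationalPolyhedral (σ : PointedCone ℝ (DualSpace M)) : Prop :=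
  ∃ s : Finset (Module.Dual ℤ M),
    σ = PointedCone.hull ℝ ((fun b : Module.Dual ℤ M => (1 : ℝ) ⊗ₜ[ℤ] b) '' (s : Set _))

/-- The semigroup `R_σ = σ^∨ ∩ M`. -/
def dualMonoid (σ : PointedCone ℝ (DualSpace M)) : AddSubmonoid M where
  carrier := {m | ∀ u ∈ σ, 0 ≤ realPairing m u}
  zero_mem' := by
    intro u _
    simp [realPairing]
  add_mem' := by
    intro x y hx hy u hu
    have h : realPairing (x + y) u = realPairing x u + realPairing y u := by
      simp [realPairing]
    rw [h]
    exact add_nonneg (hx u hu) (hy u hu)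

/-- The multiplicity `q(a) = max {k ∈ ℕ | a ∈ kN}` of a nonzero `a ∈ N`. -/
def divisibilityIndex (a : Module.Dual ℤ M) : ℕ :=
  sSup {k : ℕ | ∃ b : Module.Dual ℤ M, a = k • b}

instance twoUniqueSums [Module.Free ℤ M] : TwoUniqueSums M :=
  TwoUniqueSums.of_injective_addHom
    (Module.Free.chooseBasis ℤ M).repr.toLinearMap.toAddMonoidHom.toAddHom
    (Module.Free.chooseBasis ℤ M).repr.injective inferInstance

instance twoUniqueSums_submonoid [Module.Free ℤ M] (S : AddSubmonoid M) : TwoUniqueSums S :=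
  TwoUniqueSums.of_injective_addHom S.subtype.toAddHom Subtype.val_injective inferInstance

/-- The coordinate ring `ℂ[S]` of the affine toric variety of a semigroup `S ⊆ M`. -/
abbrev CoordRing (S : AddSubmonoid M) : Type u := AddMonoidAlgebra ℂ S

instance isDomain_coordRing [Module.Free ℤ M] (S : AddSubmonoid M) : IsDomain (CoordRing S) :=
  NoZeroDivisors.to_isDomain _

/-- The smallest value `⟨m, a⟩` over the characters `m` that occur in `g`
(and `⊤` for `g = 0`). -/
def monomialOrder (S : AddSubmonoid M) (a : Module.Dual ℤ M) (g : CoordRing S) : WithTop ℤ :=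
  g.coeff.support.inf fun m => ((a (m : M) : ℤ) : WithTop ℤ)

/-- Auxiliary homomorphism `c χ^m ↦ c χ^m t^⟨m, a⟩` to Laurent series, used only to prove that
`monomialOrder` is a valuation. -/
def weightHom (S : AddSubmonoid M) (a : Module.Dual ℤ M) :
    CoordRing S →+* HahnSeries ℤ (CoordRing S) :=
  AddMonoidAlgebra.liftNCRingHom
    ((HahnSeries.C : CoordRing S →+* HahnSeries ℤ (CoordRing S)).comp (algebraMap ℂ _))
    { toFun := fun m => HahnSeries.single (a (m.toAdd : M)) (AddMonoidAlgebra.single m.toAdd 1)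
      map_one' := by
        simp only [toAdd_one, ZeroMemClass.coe_zero, map_zero]
        rfl
      map_mul' := fun x y => by
        simp [HahnSeries.single_mul_single, AddMonoidAlgebra.single_mul_single] }
    (fun _ _ => Commute.all _ _)

theorem coeff_weightHom (S : AddSubmonoid M) (a : Module.Dual ℤ M) (g : CoordRing S) (k : ℤ)
    (m : S) :
    ((weightHom S a g).coeff k).coeff m = if a (m : M) = k then g.coeff m else 0 := by
  classical
  induction g using AddMonoidAlgebra.induction_linear with
  | zero => simp
  | add f g hf hg =>
    rw [map_add, HahnSeries.coeff_add, AddMonoidAlgebra.coeff_add, Finsupp.add_apply, hf, hg]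
    split_ifs <;> simp
  | single x c =>
    have h : weightHom S a (AddMonoidAlgebra.single x c) =
        HahnSeries.single (a (x : M)) (AddMonoidAlgebra.single x c) := by
      simp [weightHom, HahnSeries.C_apply, HahnSeries.single_mul_single,
        AddMonoidAlgebra.single_mul_single]
    rw [h, HahnSeries.coeff_single]
    by_cases hk : k = a (x : M)
    · subst hk
      by_cases hx : x = m
      · subst hx
        simp
      · simp [hx]
    · by_cases hx : x = m
      · subst hx
        simp [hk, Ne.symm hk]
      · simp [hk, hx]

theorem orderTop_weightHom (S : AddSubmonoid M) (a : Module.Dual ℤ M) (g : CoordRing S) :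
    (weightHom S a g).orderTop = monomialOrder S a g := by
  apply le_antisymm
  · refine Finset.le_inf fun m hm => HahnSeries.orderTop_le_of_coeff_ne_zero fun h => ?_
    have h2 := coeff_weightHom S a g (a (m : M)) m
    rw [h] at h2
    simp only [AddMonoidAlgebra.coeff_zero, Finsupp.coe_zero, Pi.zero_apply, if_true] at h2
    exact (Finsupp.mem_support_iff.1 hm) h2.symm
  · by_cases h0 : weightHom S a g = 0
    · simp [h0]
    rw [← HahnSeries.order_eq_orderTop_of_ne_zero h0]
    have h1 : (weightHom S a g).coeff (weightHom S a g).order ≠ 0 :=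
      HahnSeries.coeff_order_eq_zero.not.2 h0
    obtain ⟨m, hm⟩ : ∃ m, ((weightHom S a g).coeff (weightHom S a g).order).coeff m ≠ 0 := by
      by_contra! hc
      exact h1 (AddMonoidAlgebra.coeff_injective (Finsupp.ext hc))
    rw [coeff_weightHom] at hm
    split_ifs at hm with ha
    · rw [← ha]
      exact Finset.inf_le (Finsupp.mem_support_iff.2 hm)
    · exact absurd rfl hm

/-- The monomial valuation on `ℂ[S]`. -/
def monomialAddVal [Module.Free ℤ M] (S : AddSubmonoid M) (a : Module.Dual ℤ M) :
    AddValuation (CoordRing S) (WithTop ℤ) :=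
  AddValuation.of (monomialOrder S a)
    (by rw [← orderTop_weightHom, map_zero, HahnSeries.orderTop_zero])
    (by rw [← orderTop_weightHom, map_one, HahnSeries.orderTop_one])
    (fun x y => by
      simp only [← orderTop_weightHom, map_add]
      exact HahnSeries.min_orderTop_le_orderTop_add)
    (fun x y => by
      simp only [← orderTop_weightHom, map_mul, ← HahnSeries.addVal_apply]
      exact AddValuation.map_mul _ _ _)

theorem monomialAddVal_eq_top_iff [Module.Free ℤ M] (S : AddSubmonoid M) (a : Module.Dual ℤ M)
    (g : CoordRing S) : monomialAddVal S a g = ⊤ ↔ g = 0 := by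
  constructor
  · intro h
    by_contra hg
    have hs : g.coeff.support.Nonempty := by
      rw [Finsupp.support_nonempty_iff]
      simpa using hg
    obtain ⟨m, hm⟩ := hs
    have h3 : monomialOrder S a g ≤ ((a (m : M) : ℤ) : WithTop ℤ) := Finset.inf_le hm
    change monomialOrder S a g = ⊤ at h
    rw [h] at h3
    exact absurd h3 (by simp)
  · rintro rfl
    exact AddValuation.map_zero _

theorem nonZeroDivisors_le_primeCompl [Module.Free ℤ M] (S : AddSubmonoid M)
    (a : Module.Dual ℤ M) :
    nonZeroDivisors (CoordRing S) ≤
      (AddValuation.toValuation (monomialAddVal S a)).supp.primeCompl :=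
  fun _ hs h => nonZeroDivisors.ne_zero hs ((monomialAddVal_eq_top_iff S a _).1 h)

/-- The toric valuation `val_a : ℂ(X)^* → ℤ` of the fraction field of `ℂ[S]`: the extension to
quotients `g / h` of the valuation `g ↦ monomialOrder S a g` of `ℂ[S]`. -/
def toricValuation [Module.Free ℤ M] (S : AddSubmonoid M) (a : Module.Dual ℤ M) :
    AddValuation (FractionRing (CoordRing S)) (WithTop ℤ) :=
  AddValuation.ofValuation
    (Valuation.extendToLocalization (AddValuation.toValuation (monomialAddVal S a))
      (nonZeroDivisors_le_primeCompl S a)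
      (FractionRing (CoordRing S)))

/-- On the coordinate ring, `val_a (∑ c_m χ^m) = min {⟨m, a⟩ | c_m ≠ 0}`. -/
theorem toricValuation_algebraMap [Module.Free ℤ M] (S : AddSubmonoid M) (a : Module.Dual ℤ M)
    (g : CoordRing S) :
    toricValuation S a (algebraMap (CoordRing S) (FractionRing (CoordRing S)) g) =
      monomialOrder S a g :=
  Valuation.extendToLocalization_apply_map_apply
    (AddValuation.toValuation (monomialAddVal S a))
    (nonZeroDivisors_le_primeCompl S a) _ g

end Toric

end ToricMather

end

/-! Write `a = k • b` with `k = q(a)` and `b` primitive, so that `val_a = k · val_b`. Choose a basis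
`e` of `M` with `b (e i₀) = 1` and `b (e i) = 0` for the other `i`, and put `x_i = χ^{e_i}`. Strong
convexity of `σ` makes `S = σ^∨ ∩ M` generate `M`, so the function field of `X` contains `ℂ[M]`, and
in particular all the `x_i`.

If `val_a = q · ord_E` on some smooth model, then `q = k` by comparing value groups, and the local
ring `O` of `E`, viewed in the function field of `X`, is the valuation ring `{val_b ≥ 0}`. Thus `O`
does not depend on the model. It is a localization of the polynomial ring in the `x_i`
(`exists_mul_eq_of_nonneg`), so `Ω_O` is free on the `dx_i` (`exists_basis_kaehlerDifferential`).

The image of `df` is spanned by the forms `dχ^{m_1} ∧ ... ∧ dχ^{m_n}` with `m_i ∈ S`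
(`imageOfForms_eq_span`). Logarithmic differentiation shows that such a form is `det(m) · χ^{∑ m_i -
∑ e_i}` times `dx_1 ∧ ... ∧ dx_n`, where `det(m)` is the integer determinant of the `m_i` in the
basis `e` (`toricValuation_det_D`). In characteristic zero its order is `∑ b(m_i) - 1` when the
`m_i` are independent, and the form vanishes otherwise. Hence the image is `𝔪^d · ⋀ⁿ Ω_O` with `d`
the least such order, and multiplication by `k` gives the formula for `a`.

A model carrying `E` is the spectrum of the algebra of the half-lattice `b ≥ 0`, a product of an
affine line and a torus (`exists_represents_toricValuation`). -/

noncomputable section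

namespace ToricMather

/-! ### Convexity: the dual semigroup of a pointed rational cone generates the lattice. -/

section Lattice

variable {M : Type u} [AddCommGroup M]

theorem realPairing_tmul (m : M) (r : ℝ) (b : Module.Dual ℤ M) :
    realPairing m (r ⊗ₜ[ℤ] b) = r * (b m : ℝ) := by
  simp [realPairing, mul_comm]

theorem mem_dualMonoid_hull_iff (s : Finset (Module.Dual ℤ M)) (m : M) :
    m ∈ dualMonoid (PointedCone.hull ℝ
      ((fun b : Module.Dual ℤ M => (1 : ℝ) ⊗ₜ[ℤ] b) '' (s : Set _))) ↔ ∀ b ∈ s, 0 ≤ b m := by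
  constructor
  · intro h b hb
    have := h ((1 : ℝ) ⊗ₜ[ℤ] b) (Submodule.subset_span ⟨b, hb, rfl⟩)
    rw [realPairing_tmul, one_mul] at this
    exact_mod_cast this
  · intro h u hu
    refine Submodule.span_induction (p := fun u _ => 0 ≤ realPairing m u) ?_ ?_ ?_ ?_ hu
    · rintro _ ⟨b, hb, rfl⟩
      simp only [realPairing_tmul, one_mul]
      exact_mod_cast h b hb
    · simp
    · intro x y _ _ hx hy
      rw [map_add]
      exact add_nonneg hx hy
    · intro c x _ hx
      have : c • x = (c : ℝ) • x := rfl
      rw [this, map_smul]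
      exact mul_nonneg c.2 hx

theorem dualSpace_ext [Module.Free ℤ M] [Module.Finite ℤ M] {u v : DualSpace M}
    (h : ∀ m : M, realPairing m u = realPairing m v) : u = v := by
  let e := Module.Free.chooseBasis ℤ M
  apply (e.dualBasis.baseChange ℝ).ext_elem
  have key : ∀ (w : DualSpace M) i, (e.dualBasis.baseChange ℝ).repr w i = realPairing (e i) w := by
    intro w i
    induction w using TensorProduct.induction_on with
    | zero => simp
    | tmul r b =>
      rw [realPairing_tmul, Module.Basis.baseChange_repr_tmul]
      simp [mul_comm]
    | add x y hx hy => simp [hx, hy]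
  intro i
  rw [key, key, h]

/-- Gordan's alternative over the integers: finitely many nonzero integral functionals that admit no
nontrivial nonnegative real relation are simultaneously positive at a lattice point. -/
theorem exists_forall_pos [Module.Free ℤ M] [Module.Finite ℤ M] (s : Finset (Module.Dual ℤ M))
    (hs : ∀ w : Module.Dual ℤ M → ℝ, (∀ b ∈ s, 0 ≤ w b) →
      (∀ m : M, ∑ b ∈ s, w b * (b m : ℝ) = 0) → ∀ b ∈ s, w b = 0) :
    ∃ m₀ : M, ∀ b ∈ s, 0 < b m₀ := by
  classical
  let e := Module.Free.chooseBasis ℤ M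
  let c : Module.Dual ℤ M → (Module.Free.ChooseBasisIndex ℤ M → ℝ) := fun b i => (b (e i) : ℝ)
  have hsum : ∀ (b : Module.Dual ℤ M) (m : M), (b m : ℝ) = ∑ i, (e.repr m i : ℝ) * c b i := by
    intro b m
    conv_lhs => rw [← e.sum_repr m, map_sum]
    push_cast
    simp only [map_smul, smul_eq_mul, Int.cast_mul, c]
  have h0 : (0 : Module.Free.ChooseBasisIndex ℤ M → ℝ) ∉ convexHull ℝ (c '' (s : Set _)) := by
    intro h
    rw [← Finset.coe_image, Finset.mem_convexHull'] at h
    obtain ⟨w, hw0, hw1, hw⟩ := h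
    have hc : Function.Injective c := by
      intro b b' hbb
      apply e.ext
      intro i
      have := congrFun hbb i
      exact Int.cast_injective (α := ℝ) this
    rw [Finset.sum_image (fun x _ y _ h => hc h)] at hw1 hw
    have h1 := hs (fun b => w (c b)) (fun b hb => hw0 _ (Finset.mem_image_of_mem _ hb)) (by
      intro m
      have h2 : ∀ i, ∑ b ∈ s, w (c b) * c b i = 0 := by
        intro i
        have := congrFun hw i
        simpa [Finset.sum_apply] using this
      simp_rw [hsum, Finset.mul_sum]
      rw [Finset.sum_comm]
      refine Finset.sum_eq_zero fun i _ => ?_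
      have := congrArg (fun x => (e.repr m i : ℝ) * x) (h2 i)
      simp only [Finset.mul_sum, mul_zero] at this
      rw [← this]
      exact Finset.sum_congr rfl fun b _ => by ring)
    rw [Finset.sum_eq_zero h1] at hw1
    exact zero_ne_one hw1
  -- The separating functional is negative on every `c b`, so `-f` gives a real solution of the
  -- strict inequalities.
  obtain ⟨f, u, hfu, hu⟩ := geometric_hahn_banach_closed_point (convex_convexHull ℝ _)
    ((s.finite_toSet.image c).isClosed_convexHull ℝ) h0
  rw [map_zero] at hu
  -- The solution set is open, hence contains a rational point, which is then scaled into the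
  -- lattice.
  let U : Set (Module.Free.ChooseBasisIndex ℤ M → ℝ) := ⋂ b ∈ s, {y | 0 < ∑ i, y i * c b i}
  have hU : IsOpen U := by
    refine isOpen_biInter_finset fun b _ => isOpen_lt continuous_const ?_
    fun_prop
  have hUne : U.Nonempty := by
    refine ⟨fun i => -f (Pi.single i 1), ?_⟩
    simp only [U, Set.mem_iInter, Set.mem_ofPred_eq]
    intro b hb
    have h1 := hfu (c b) (subset_convexHull ℝ _ ⟨b, hb, rfl⟩)
    have h2 : f (c b) = ∑ i, c b i * f (Pi.single i 1) := by
      conv_lhs => rw [pi_eq_sum_univ' (c b)]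
      simp [map_sum]
    simp only [neg_mul, Finset.sum_neg_distrib]
    rw [h2] at h1
    have h3 : ∑ i, f (Pi.single i 1) * c b i = ∑ i, c b i * f (Pi.single i 1) :=
      Finset.sum_congr rfl fun i _ => mul_comm _ _
    linarith
  have hd : DenseRange (Pi.map (fun (_ : Module.Free.ChooseBasisIndex ℤ M) (q : ℚ) => (q : ℝ))) :=
    DenseRange.piMap fun _ => Rat.denseRange_cast
  obtain ⟨q, hq⟩ := hd.exists_mem_open hU hUne
  obtain ⟨d, hdq⟩ := IsLocalization.exist_integer_multiples_of_finite (nonZeroDivisors ℤ) q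
  choose z hz using hdq
  have hd0 : (d : ℤ) ≠ 0 := nonZeroDivisors.ne_zero d.2
  -- Since `z = d q` and the sign of the denominator `d` is unknown, the extra factor `d` makes the
  -- scaling factor `d ^ 2 > 0`.
  refine ⟨∑ i, ((d : ℤ) * z i) • e i, fun b hb => ?_⟩
  simp only [U, Set.mem_iInter, Set.mem_ofPred_eq] at hq
  have h1 := hq b hb
  have h2 : ((b (∑ i, ((d : ℤ) * z i) • e i) : ℤ) : ℝ) =
      ((d : ℤ) : ℝ) ^ 2 * ∑ i, (Pi.map (fun _ (q : ℚ) => (q : ℝ)) q) i * c b i := by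
    have hz' : ∀ i, ((z i : ℤ) : ℝ) = ((d : ℤ) : ℝ) * (q i : ℝ) := by
      intro i
      have := hz i
      have h3 : ((z i : ℤ) : ℚ) = ((d : ℤ) : ℚ) * q i := by
        simpa [Submonoid.smul_def] using this
      exact_mod_cast congrArg (fun x : ℚ => (x : ℝ)) h3
    simp only [map_sum, map_smul, smul_eq_mul, Int.cast_sum, Int.cast_mul, hz', Pi.map_apply,
      Finset.mul_sum, c]
    exact Finset.sum_congr rfl fun i _ => by ring
  have h3 : (0 : ℝ) < ((d : ℤ) : ℝ) ^ 2 := by positivity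
  exact_mod_cast h2 ▸ mul_pos h3 h1

variable [Module.Free ℤ M] [Module.Finite ℤ M]

/-- The semigroup `σ^∨ ∩ M` of a strongly convex rational cone generates `M`. -/
theorem exists_add_mem_dualMonoid {σ : PointedCone ℝ (DualSpace M)}
    (hσ_rat : IsRationalPolyhedral σ) (hσ_pointed : ∀ u ∈ σ, -u ∈ σ → u = 0) (m : M) :
    ∃ t ∈ dualMonoid σ, m + t ∈ dualMonoid σ := by
  classical
  obtain ⟨s, rfl⟩ := hσ_rat
  -- In a nonnegative relation among the generators, the negative of each term is a sum of the
  -- others and so lies in `σ`; pointedness makes the term zero. The generator `0` is removed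
  -- because it is positive nowhere.
  obtain ⟨m₀, hm₀⟩ := exists_forall_pos (s.erase 0) (by
    intro w hw h b hb
    set σ := PointedCone.hull ℝ
      ((fun b : Module.Dual ℤ M => (1 : ℝ) ⊗ₜ[ℤ] b) '' (s : Set _)) with hσ
    have hmem : ∀ b ∈ s.erase 0, w b ⊗ₜ[ℤ] b ∈ σ := by
      intro b hb
      have : w b ⊗ₜ[ℤ] b = (⟨w b, hw b hb⟩ : {r : ℝ // 0 ≤ r}) • ((1 : ℝ) ⊗ₜ[ℤ] b) := by
        rw [Nonneg.mk_smul, TensorProduct.smul_tmul', smul_eq_mul, mul_one]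
      rw [this]
      exact Submodule.smul_mem _ _ (Submodule.subset_span ⟨b, Finset.mem_of_mem_erase hb, rfl⟩)
    have hneg : -(w b ⊗ₜ[ℤ] b) = ∑ b' ∈ (s.erase 0).erase b, w b' ⊗ₜ[ℤ] b' := by
      refine dualSpace_ext fun m => ?_
      rw [map_neg, map_sum]
      simp only [realPairing_tmul]
      have h1 := h m
      rw [← Finset.add_sum_erase _ _ hb] at h1
      linarith
    have h0 := hσ_pointed _ (hmem b hb) (hneg ▸ Submodule.sum_mem _ fun b' hb' =>
      hmem b' (Finset.mem_of_mem_erase hb'))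
    by_contra hwb
    refine Finset.ne_of_mem_erase hb (LinearMap.ext fun m => ?_)
    have h1 := congrArg (realPairing m) h0
    rw [realPairing_tmul, map_zero] at h1
    simpa [hwb] using h1)
  simp only [mem_dualMonoid_hull_iff]
  have hm₀' : ∀ b ∈ s, 0 ≤ b m₀ := by
    intro b hb
    by_cases hb0 : b = 0
    · simp [hb0]
    · exact (hm₀ b (Finset.mem_erase.2 ⟨hb0, hb⟩)).le
  -- As `b m₀ ≥ 1` for every nonzero generator `b`, this multiple of `m₀` outweighs any negative
  -- value `b m`.
  refine ⟨(∑ b ∈ s, |b m|) • m₀, fun b hb => ?_, fun b hb => ?_⟩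
  · rw [map_smul, smul_eq_mul]
    exact mul_nonneg (Finset.sum_nonneg fun _ _ => abs_nonneg _) (hm₀' b hb)
  · by_cases hb0 : b = 0
    · simp [hb0]
    rw [map_add, map_smul, smul_eq_mul]
    have h1 : |b m| ≤ ∑ b ∈ s, |b m| :=
      Finset.single_le_sum (f := fun b : Module.Dual ℤ M => |b m|) (fun _ _ => abs_nonneg _) hb
    have h2 := hm₀ b (Finset.mem_erase.2 ⟨hb0, hb⟩)
    have h3 := neg_abs_le (b m)
    nlinarith [abs_nonneg (b m)]

end Lattice

/-! ### Primitive functionals, adapted bases and determinants. -/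

section Basis

variable {M : Type u} [AddCommGroup M]

/-- The range of `b` is an ideal `dℤ`. If `|d| > 1`, dividing `b` by `|d|` would exhibit a larger
divisor of `a` than the maximal one. -/
theorem divisibilityIndex_spec {a : Module.Dual ℤ M} (ha : a ≠ 0) :
    0 < divisibilityIndex a ∧
      ∃ b : Module.Dual ℤ M, a = divisibilityIndex a • b ∧ Function.Surjective b := by
  set s : Set ℕ := {k : ℕ | ∃ b : Module.Dual ℤ M, a = k • b} with hs
  obtain ⟨m, hm⟩ : ∃ m, a m ≠ 0 := by
    by_contra! h
    exact ha (LinearMap.ext h)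
  -- An unbounded set would have `sSup` equal to the default `0`; here every `k ∈ s` divides the
  -- nonzero integer `a m`.
  have hbdd : BddAbove s := by
    refine ⟨(a m).natAbs, ?_⟩
    rintro k ⟨b, hb⟩
    refine Nat.le_of_dvd (Int.natAbs_pos.2 hm) ?_
    rw [← Int.natCast_dvd]
    exact ⟨b m, by rw [hb]; simp⟩
  have h1 : 1 ∈ s := ⟨a, by simp⟩
  have hpos : 0 < divisibilityIndex a := Nat.lt_of_lt_of_le one_pos (le_csSup hbdd h1)
  obtain ⟨b, hb⟩ : divisibilityIndex a ∈ s := Nat.sSup_mem ⟨1, h1⟩ hbdd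
  refine ⟨hpos, b, hb, ?_⟩
  obtain ⟨d, hd⟩ := (IsPrincipalIdealRing.principal (LinearMap.range b)).principal
  have hdvd : ∀ x, d.natAbs ∣ (b x).natAbs := by
    intro x
    have : b x ∈ LinearMap.range b := ⟨x, rfl⟩
    rw [hd, Submodule.mem_span_singleton] at this
    obtain ⟨c, hc⟩ := this
    rw [Int.natAbs_dvd_natAbs]
    exact ⟨c, by rw [← hc]; simp [mul_comm]⟩
  have hd0 : d.natAbs ≠ 0 := by
    intro h
    have := hdvd m
    rw [h, zero_dvd_iff, Int.natAbs_eq_zero] at this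
    exact hm (by rw [hb]; simp [this])
  have hmem : divisibilityIndex a * d.natAbs ∈ s := by
    have hdvd' : ∀ x, ((d.natAbs : ℕ) : ℤ) ∣ b x := fun x => Int.natCast_dvd.2 (hdvd x)
    have hdz : ((d.natAbs : ℕ) : ℤ) ≠ 0 := by exact_mod_cast hd0
    refine ⟨{ toFun := fun x => b x / (d.natAbs : ℕ)
              map_add' := fun x y => by rw [map_add, Int.add_ediv_of_dvd_left (hdvd' x)]
              map_smul' := fun c x => by
                rw [map_smul, smul_eq_mul, Int.mul_ediv_assoc _ (hdvd' x)]
                rfl }, ?_⟩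
    rw [mul_smul]
    conv_lhs => rw [hb]
    congr 1
    ext x
    simp only [LinearMap.smul_apply, LinearMap.coe_mk, AddHom.coe_mk, nsmul_eq_mul]
    exact (Int.mul_ediv_cancel' (hdvd' x)).symm
  have hle : divisibilityIndex a * d.natAbs ≤ divisibilityIndex a := le_csSup hbdd hmem
  have hd1 : d.natAbs = 1 := by nlinarith [Nat.pos_of_ne_zero hd0]
  have hu : IsUnit d := Int.isUnit_iff_natAbs_eq.2 hd1
  rw [← LinearMap.range_eq_top, hd]
  exact Ideal.span_singleton_eq_top.2 hu

theorem linearIndependent_iff_det_ne_zero {n : ℕ} (e : Module.Basis (Fin n) ℤ M) (x : Fin n → M) :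
    LinearIndependent ℤ x ↔ e.det x ≠ 0 := by
  have h : LinearIndependent ℤ x ↔ LinearIndependent ℤ (e.toMatrix x).col :=
    (LinearMap.linearIndependent_iff e.equivFun.toLinearMap e.equivFun.ker).symm
  rw [h, Module.Basis.det_apply]
  exact ⟨fun h h0 => (Matrix.exists_mulVec_eq_zero_iff.2 h0).elim fun v hv =>
    hv.1 (Matrix.mulVec_injective_iff.2 h (hv.2.trans (Matrix.mulVec_zero _).symm)),
    Matrix.linearIndependent_cols_of_det_ne_zero⟩

variable [Module.Free ℤ M] [Module.Finite ℤ M]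

/-- If `b y = 1` then `M = ℤy ⊕ ker b`. In such coordinates the character of `e i₀` is a uniformizer
along the divisor of `b`, and the other basis characters are units there. -/
theorem exists_adapted_basis {b : Module.Dual ℤ M} (hb : Function.Surjective b) :
    ∃ (e : Module.Basis (Fin (Module.finrank ℤ M)) ℤ M) (i₀ : Fin (Module.finrank ℤ M)),
      ∀ i, b (e i) = if i = i₀ then 1 else 0 := by
  obtain ⟨y, hy⟩ := hb 1
  let f := Module.finBasis ℤ (LinearMap.ker b)
  let e := Module.Basis.mkFinCons y f (by
    intro c x hx h
    have := congrArg b h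
    rw [map_add, map_smul, hy, LinearMap.mem_ker.1 hx] at this
    simpa using this) (fun z => ⟨-b z, by simp [LinearMap.mem_ker, hy]⟩)
  have hn : Module.finrank ℤ (LinearMap.ker b) + 1 = Module.finrank ℤ M := by
    rw [Module.finrank_eq_card_basis e, Fintype.card_fin]
  refine ⟨e.reindex (finCongr hn), finCongr hn 0, fun i => ?_⟩
  obtain ⟨j, rfl⟩ := (finCongr hn).surjective i
  rw [Module.Basis.reindex_apply, Equiv.symm_apply_apply]
  simp only [(finCongr hn).injective.eq_iff]
  refine Fin.cases ?_ (fun j => ?_) j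
  · simp [e, hy]
  · have : b (f j : M) = 0 := (f j).2
    simp [e, this]

/-- If all tuples from `S` were dependent, the determinant, as a linear form on the top exterior
power of `M`, would vanish on the wedges of elements of the spanning set `S`, hence everywhere. -/
theorem exists_linearIndependent_mem {S : AddSubmonoid M}
    (hS : ∀ m : M, ∃ t ∈ S, m + t ∈ S) :
    ∃ x : Fin (Module.finrank ℤ M) → M, (∀ i, x i ∈ S) ∧ LinearIndependent ℤ x := by
  let e := Module.finBasis ℤ M
  by_contra! h
  have hspan : Submodule.span ℤ (S : Set M) = ⊤ := by
    refine eq_top_iff.2 fun m _ => ?_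
    obtain ⟨t, ht, hmt⟩ := hS m
    have := Submodule.sub_mem (Submodule.span ℤ (S : Set M)) (Submodule.subset_span hmt)
      (Submodule.subset_span ht)
    rwa [add_sub_cancel_right] at this
  have h1 : exteriorPower.alternatingMapLinearEquiv e.det = 0 := by
    refine LinearMap.ext_on (exteriorPower.ιMulti_span_of_span ℤ _ M hspan) ?_
    rintro _ ⟨x, hx, rfl⟩
    have := h x fun i => hx ⟨i, rfl⟩
    rw [linearIndependent_iff_det_ne_zero e, not_not] at this
    simpa using this
  have h2 : e.det = 0 :=
    exteriorPower.alternatingMapLinearEquiv.injective (h1.trans (map_zero _).symm)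
  exact e.det_ne_zero h2

end Basis

/-! ### The torus inside the toric variety. -/

section Torus

variable {M : Type u} [AddCommGroup M]

/-- The inclusion `ℂ[S] → ℂ[M]` of the coordinate ring of the toric variety in that of its
torus. -/
def toTorus (S : AddSubmonoid M) : CoordRing S →ₐ[ℂ] AddMonoidAlgebra ℂ M :=
  AddMonoidAlgebra.mapDomainAlgHom ℂ ℂ S.subtype

theorem toTorus_single (S : AddSubmonoid M) (s : S) (c : ℂ) :
    toTorus S (AddMonoidAlgebra.single s c) = AddMonoidAlgebra.single (s : M) c := by
  simp [toTorus]

theorem exists_mul_single_eq_toTorus {S : AddSubmonoid M} (hS : ∀ m : M, ∃ t ∈ S, m + t ∈ S)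
    (g : AddMonoidAlgebra ℂ M) :
    ∃ (t : S) (f : CoordRing S), g * AddMonoidAlgebra.single (t : M) 1 = toTorus S f := by
  induction g using AddMonoidAlgebra.induction_linear with
  | zero => exact ⟨0, 0, by simp⟩
  | add g₁ g₂ h₁ h₂ =>
    obtain ⟨t₁, f₁, h₁⟩ := h₁
    obtain ⟨t₂, f₂, h₂⟩ := h₂
    refine ⟨t₁ + t₂, f₁ * AddMonoidAlgebra.single t₂ 1 + f₂ * AddMonoidAlgebra.single t₁ 1, ?_⟩
    have h : (AddMonoidAlgebra.single ((t₁ + t₂ : S) : M) 1 : AddMonoidAlgebra ℂ M) =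
        AddMonoidAlgebra.single (t₁ : M) 1 * AddMonoidAlgebra.single (t₂ : M) 1 := by
      simp [AddMonoidAlgebra.single_mul_single]
    rw [map_add, map_mul, map_mul, ← h₁, ← h₂, toTorus_single, toTorus_single, h]
    ring
  | single m c =>
    obtain ⟨t, ht, hmt⟩ := hS m
    refine ⟨⟨t, ht⟩, AddMonoidAlgebra.single ⟨m + t, hmt⟩ c, ?_⟩
    rw [toTorus_single, AddMonoidAlgebra.single_mul_single, mul_one]

variable [Module.Free ℤ M]

/-- The function field of the affine toric variety of `S` contains the coordinate ring of the
torus. -/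
theorem exists_torusHom {S : AddSubmonoid M} (hS : ∀ m : M, ∃ t ∈ S, m + t ∈ S) :
    ∃ Φ : AddMonoidAlgebra ℂ M →ₐ[ℂ] FractionRing (CoordRing S), Function.Injective Φ ∧
      ∀ f, Φ (toTorus S f) = algebraMap (CoordRing S) (FractionRing (CoordRing S)) f := by
  choose t ht hmt using hS
  let c : S → FractionRing (CoordRing S) := fun s =>
    algebraMap (CoordRing S) (FractionRing (CoordRing S)) (AddMonoidAlgebra.single s 1)
  have hc0 : ∀ s, c s ≠ 0 := fun s => by
    simp only [c, ne_eq, FaithfulSMul.algebraMap_eq_zero_iff]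
    intro h
    have := congrArg (fun f : CoordRing S => f.coeff s) h
    simp at this
  have hcadd : ∀ s s', c s * c s' = c (s + s') := fun s s' => by
    simp only [c]
    rw [← map_mul, AddMonoidAlgebra.single_mul_single, mul_one]
  -- A character `m` is the quotient of `m + t` by `t`, both in `S`; additivity of characters makes
  -- the choice of `t` irrelevant.
  let χ : Multiplicative M →* FractionRing (CoordRing S) :=
    { toFun := fun m => c ⟨m.toAdd + t m.toAdd, hmt _⟩ / c ⟨t m.toAdd, ht _⟩
      map_one' := by
        rw [div_eq_one_iff_eq (hc0 _)]
        congr 2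
        simp
      map_mul' := fun x y => by
        rw [div_mul_div_comm, div_eq_div_iff (hc0 _) (mul_ne_zero (hc0 _) (hc0 _))]
        simp only [hcadd]
        congr 1
        apply Subtype.ext
        simp only [AddSubmonoid.coe_add, toAdd_mul]
        abel }
  have hχ : ∀ s : S, χ (Multiplicative.ofAdd (s : M)) = c s := fun s => by
    simp only [χ, MonoidHom.coe_mk, OneHom.coe_mk, toAdd_ofAdd]
    rw [div_eq_iff (hc0 _), hcadd]
    rfl
  let Φ := AddMonoidAlgebra.lift ℂ (FractionRing (CoordRing S)) M χ
  have hΦ : ∀ f, Φ (toTorus S f) = algebraMap (CoordRing S) (FractionRing (CoordRing S)) f := by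
    intro f
    induction f using AddMonoidAlgebra.induction_linear with
    | zero => simp
    | add f g hf hg => rw [map_add, map_add, map_add, hf, hg]
    | single s a =>
      rw [toTorus_single, AddMonoidAlgebra.lift_single, hχ]
      simp only [c]
      rw [← IsScalarTower.algebraMap_smul (CoordRing S) a, Algebra.smul_def, ← map_mul]
      simp [AddMonoidAlgebra.single_mul_single]
  -- Multiplying by a character from `S` moves `g` into `ℂ[S]`, where injectivity is known, and that
  -- character is a unit of `ℂ[M]`.
  refine ⟨Φ, (injective_iff_map_eq_zero Φ).2 fun g hg => ?_, hΦ⟩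
  obtain ⟨s, f, h⟩ := exists_mul_single_eq_toTorus (fun m => ⟨t m, ht m, hmt m⟩) g
  have h1 := hΦ f
  rw [← h, map_mul, hg, zero_mul, eq_comm, FaithfulSMul.algebraMap_eq_zero_iff] at h1
  rw [h1, map_zero] at h
  have h2 : (AddMonoidAlgebra.single (s : M) 1 : AddMonoidAlgebra ℂ M) *
      AddMonoidAlgebra.single (-(s : M)) 1 = 1 := by
    rw [AddMonoidAlgebra.single_mul_single, add_neg_cancel, mul_one]
    rfl
  rw [← mul_one g, ← h2, ← mul_assoc, h, zero_mul]

variable {S : AddSubmonoid M} {Φ : AddMonoidAlgebra ℂ M →ₐ[ℂ] FractionRing (CoordRing S)}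

theorem toricValuation_character (hS : ∀ m : M, ∃ t ∈ S, m + t ∈ S)
    (hΦ : ∀ f, Φ (toTorus S f) = algebraMap (CoordRing S) (FractionRing (CoordRing S)) f)
    (b : Module.Dual ℤ M) (m : M) {c : ℂ} (hc : c ≠ 0) :
    toricValuation S b (Φ (AddMonoidAlgebra.single m c)) = ((b m : ℤ) : WithTop ℤ) := by
  have hs : ∀ (s : S) (c : ℂ), c ≠ 0 → toricValuation S b (Φ (AddMonoidAlgebra.single (s : M) c)) =
      ((b s : ℤ) : WithTop ℤ) := by
    intro s c hc
    rw [← toTorus_single, hΦ, toricValuation_algebraMap, monomialOrder]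
    simp [Finsupp.support_single _ hc]
  obtain ⟨t, ht, hmt⟩ := hS m
  have h1 := hs ⟨m + t, hmt⟩ c hc
  have h2 := hs ⟨t, ht⟩ 1 one_ne_zero
  have h3 : (AddMonoidAlgebra.single (m + t) c : AddMonoidAlgebra ℂ M) =
      AddMonoidAlgebra.single m c * AddMonoidAlgebra.single t 1 := by
    rw [AddMonoidAlgebra.single_mul_single, mul_one]
  simp only at h1 h2
  rw [h3, map_mul, AddValuation.map_mul, h2, map_add, WithTop.coe_add] at h1
  exact (WithTop.add_right_inj WithTop.coe_ne_top).1 h1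

end Torus

/-! ### Polynomial coordinates along the divisor of a primitive functional. -/

section Chart

theorem repr_eq_apply_of_adapted {M ι : Type*} [AddCommGroup M] [Fintype ι] [DecidableEq ι]
    (e : Module.Basis ι ℤ M) {b : Module.Dual ℤ M} {i₀ : ι}
    (he : ∀ i, b (e i) = if i = i₀ then 1 else 0) (m : M) : e.repr m i₀ = b m := by
  conv_rhs => rw [← e.sum_repr m, map_sum]
  simp [he]

variable {M : Type u} [AddCommGroup M] {ι : Type*} (e : Module.Basis ι ℤ M)

/-- The inclusion of the polynomial ring on a basis of `M` in the coordinate ring of the torus. -/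
def toTorusOfBasis : MvPolynomial ι ℂ →ₐ[ℂ] AddMonoidAlgebra ℂ M :=
  AddMonoidAlgebra.mapDomainAlgHom ℂ ℂ (Finsupp.linearCombination ℕ e).toAddMonoidHom

theorem repr_linearCombination_nat (α : ι →₀ ℕ) (i : ι) :
    e.repr (Finsupp.linearCombination ℕ e α) i = α i := by
  classical
  induction α using Finsupp.induction_linear with
  | zero => simp
  | add f g hf hg => simp [hf, hg]
  | single j k => simp [Finsupp.single_apply]

theorem toTorusOfBasis_injective : Function.Injective (toTorusOfBasis e) := by
  refine AddMonoidAlgebra.mapDomain_injective fun α β h => Finsupp.ext fun i => ?_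
  have h1 := repr_linearCombination_nat e α i
  have h2 : Finsupp.linearCombination ℕ e α = Finsupp.linearCombination ℕ e β := h
  rw [h2, repr_linearCombination_nat] at h1
  exact_mod_cast h1.symm

theorem toTorusOfBasis_monomial (α : ι →₀ ℕ) (c : ℂ) :
    toTorusOfBasis e (MvPolynomial.monomial α c) =
      AddMonoidAlgebra.single (Finsupp.linearCombination ℕ e α) c :=
  AddMonoidAlgebra.mapDomain_single

theorem toTorusOfBasis_X (i : ι) :
    toTorusOfBasis e (MvPolynomial.X i) = AddMonoidAlgebra.single (e i) 1 := by
  rw [MvPolynomial.X, toTorusOfBasis_monomial]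
  simp

theorem exists_toTorusOfBasis_eq_single {m : M} (hm : ∀ i, 0 ≤ e.repr m i) (c : ℂ) :
    ∃ f, toTorusOfBasis e f = AddMonoidAlgebra.single m c := by
  refine ⟨MvPolynomial.monomial ((e.repr m).mapRange Int.toNat rfl) c, ?_⟩
  rw [toTorusOfBasis_monomial]
  congr 1
  apply e.repr.injective
  ext i
  rw [repr_linearCombination_nat]
  simp [hm i]

theorem exists_toTorusOfBasis_eq {S : AddSubmonoid M} (x : CoordRing S) (c : M)
    (h : ∀ s ∈ x.coeff.support, ∀ i, 0 ≤ e.repr ((s : M) + c) i) :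
    ∃ f, toTorusOfBasis e f = toTorus S x * AddMonoidAlgebra.single c 1 := by
  suffices toTorus S x * AddMonoidAlgebra.single c 1 ∈ (toTorusOfBasis e).range from this
  rw [← AddMonoidAlgebra.sum_coeff_single x, Finsupp.sum, map_sum, Finset.sum_mul]
  refine Subalgebra.sum_mem _ fun s hs => ?_
  rw [toTorus_single, AddMonoidAlgebra.single_mul_single, mul_one]
  exact exists_toTorusOfBasis_eq_single e (h s hs) _

variable [Module.Free ℤ M] {S : AddSubmonoid M}
  {Φ : AddMonoidAlgebra ℂ M →ₐ[ℂ] FractionRing (CoordRing S)}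

/-- Every rational function regular along the divisor of `b` is a quotient of two polynomials in the
coordinates of an adapted basis, whose denominator does not vanish along that divisor. -/
theorem exists_mul_eq_of_nonneg [Fintype ι] [DecidableEq ι]
    (hS : ∀ m : M, ∃ t ∈ S, m + t ∈ S)
    (hΦ : ∀ f, Φ (toTorus S f) = algebraMap (CoordRing S) (FractionRing (CoordRing S)) f)
    {b : Module.Dual ℤ M} {i₀ : ι} (he : ∀ i, b (e i) = if i = i₀ then 1 else 0)
    {h : FractionRing (CoordRing S)} (hh : 0 ≤ toricValuation S b h) :
    ∃ f g, Φ (toTorusOfBasis e f) = h * Φ (toTorusOfBasis e g) ∧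
      toricValuation S b (Φ (toTorusOfBasis e g)) = 0 := by
  classical
  obtain ⟨x, y, hy, rfl⟩ := IsFractionRing.div_surjective (A := CoordRing S) h
  have hy0 : y ≠ 0 := nonZeroDivisors.ne_zero hy
  have hyK : algebraMap (CoordRing S) (FractionRing (CoordRing S)) y ≠ 0 := by
    simpa using hy0
  have hb := repr_eq_apply_of_adapted e he
  obtain ⟨k, hk⟩ : ∃ k : ℤ, monomialOrder S b y = k := by
    obtain ⟨k, hk⟩ := WithTop.ne_top_iff_exists.1
      (fun h => hy0 ((monomialAddVal_eq_top_iff S b y).1 h))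
    exact ⟨k, hk.symm⟩
  have hxy : monomialOrder S b y ≤ monomialOrder S b x := by
    rw [← toricValuation_algebraMap, ← toricValuation_algebraMap]
    have : algebraMap (CoordRing S) (FractionRing (CoordRing S)) x =
        (algebraMap (CoordRing S) (FractionRing (CoordRing S)) x /
          algebraMap (CoordRing S) (FractionRing (CoordRing S)) y) *
          algebraMap (CoordRing S) (FractionRing (CoordRing S)) y := by
      rw [div_mul_cancel₀ _ hyK]
    rw [this, AddValuation.map_mul]
    exact le_add_of_nonneg_left hh
  have hkx : ∀ s ∈ x.coeff.support ∪ y.coeff.support, k ≤ b (s : M) := by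
    intro s hs
    have : (k : WithTop ℤ) ≤ ((b s : ℤ) : WithTop ℤ) := by
      rw [← hk]
      rcases Finset.mem_union.1 hs with hs | hs
      · exact hxy.trans (Finset.inf_le hs)
      · exact Finset.inf_le hs
    exact WithTop.coe_le_coe.1 this
  -- Numerator and denominator are both multiplied by `χ^c`. The coordinate `-k` at `i₀` brings the
  -- order of the denominator to zero, and `N` is large enough to make all other exponents
  -- nonnegative.
  let N : ℤ := ∑ s ∈ x.coeff.support ∪ y.coeff.support, ∑ i, |e.repr (s : M) i|
  let c : M := ∑ i, (if i = i₀ then -k else N) • e i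
  have hc : ∀ i, e.repr c i = if i = i₀ then -k else N := by
    intro i
    simp only [c]
    rw [e.repr_sum_self]
  have hpos : ∀ s ∈ x.coeff.support ∪ y.coeff.support, ∀ i, 0 ≤ e.repr ((s : M) + c) i := by
    intro s hs i
    rw [map_add, Finsupp.add_apply, hc]
    split_ifs with hi
    · rw [hi, hb]
      linarith [hkx s hs]
    · have h1 : |e.repr (s : M) i| ≤ ∑ i, |e.repr (s : M) i| :=
        Finset.single_le_sum (f := fun i => |e.repr (s : M) i|) (fun _ _ => abs_nonneg _)
          (Finset.mem_univ i)
      have h2 : ∑ i, |e.repr (s : M) i| ≤ N :=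
        Finset.single_le_sum (f := fun s : S => ∑ i, |e.repr (s : M) i|)
          (fun _ _ => Finset.sum_nonneg fun _ _ => abs_nonneg _) hs
      linarith [neg_abs_le (e.repr (s : M) i)]
  obtain ⟨f, hf⟩ := exists_toTorusOfBasis_eq e x c fun s hs => hpos s (Finset.mem_union_left _ hs)
  obtain ⟨g, hg⟩ := exists_toTorusOfBasis_eq e y c fun s hs => hpos s (Finset.mem_union_right _ hs)
  refine ⟨f, g, ?_, ?_⟩
  · rw [hf, hg, map_mul, map_mul, hΦ, hΦ, ← mul_assoc, div_mul_cancel₀ _ hyK]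
  · rw [hg, map_mul, hΦ, AddValuation.map_mul, toricValuation_algebraMap, hk,
      toricValuation_character hS hΦ b c one_ne_zero, ← hb c, hc, if_pos rfl, ← WithTop.coe_add,
      add_neg_cancel]
    rfl

theorem toricValuation_toTorusOfBasis_nonneg [Fintype ι] [DecidableEq ι]
    (hS : ∀ m : M, ∃ t ∈ S, m + t ∈ S)
    (hΦ : ∀ f, Φ (toTorus S f) = algebraMap (CoordRing S) (FractionRing (CoordRing S)) f)
    {b : Module.Dual ℤ M} {i₀ : ι} (he : ∀ i, b (e i) = if i = i₀ then 1 else 0)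
    (f : MvPolynomial ι ℂ) :
    0 ≤ toricValuation S b (Φ (toTorusOfBasis e f)) := by
  have hX : ∀ i, 0 ≤ toricValuation S b (Φ (toTorusOfBasis e (MvPolynomial.X i))) := fun i => by
    rw [toTorusOfBasis_X, toricValuation_character hS hΦ b _ one_ne_zero, he]
    split_ifs <;> norm_num
  induction f using MvPolynomial.induction_on with
  | C a =>
    by_cases ha : a = 0
    · simp [ha]
    rw [MvPolynomial.C_apply, toTorusOfBasis_monomial, toricValuation_character hS hΦ b _ ha]
    simp
  | add p q hp hq =>
    rw [map_add, map_add]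
    exact (le_min hp hq).trans (AddValuation.map_add _ _ _)
  | mul_X p i hp =>
    rw [map_mul, map_mul, AddValuation.map_mul]
    exact add_nonneg hp (hX i)

end Chart

/-! ### Discrete valuation rings inside a field. -/

section ValuationRing

variable {O K : Type*} [CommRing O] [Field K] [Algebra O K] [FaithfulSMul O K]
  {v : AddValuation K (WithTop ℤ)}

/-- Throughout this part `hO` says that the image of `O` is the valuation ring of `v`. A unit and
its inverse both have nonnegative value, and conversely value zero puts the inverse into `O`. -/
theorem isUnit_iff_of_mem_iff_nonneg
    (hO : ∀ h : K, (∃ o, algebraMap O K o = h) ↔ 0 ≤ v h) (o : O) :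
    IsUnit o ↔ v (algebraMap O K o) = 0 := by
  have hnn : ∀ o, 0 ≤ v (algebraMap O K o) := fun o => (hO _).1 ⟨o, rfl⟩
  constructor
  · intro h
    obtain ⟨u, rfl⟩ := h
    have h1 : v (algebraMap O K u) + v (algebraMap O K ↑u⁻¹) = 0 := by
      rw [← AddValuation.map_mul, ← map_mul, Units.mul_inv, map_one, AddValuation.map_one]
    exact le_antisymm (h1 ▸ le_add_of_nonneg_right (hnn _)) (hnn _)
  · intro h
    have h0 : algebraMap O K o ≠ 0 := by
      intro h0
      rw [h0, AddValuation.map_zero] at h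
      exact WithTop.top_ne_zero h
    obtain ⟨o', ho'⟩ := (hO (algebraMap O K o)⁻¹).2 (by
      have h1 : v (algebraMap O K o)⁻¹ + v (algebraMap O K o) = 0 := by
        rw [← AddValuation.map_mul, inv_mul_cancel₀ h0, AddValuation.map_one]
      rw [h, add_zero] at h1
      exact h1.ge)
    refine IsUnit.of_mul_eq_one o' (FaithfulSMul.algebraMap_injective O K ?_)
    rw [map_mul, ho', map_one, mul_inv_cancel₀ h0]

theorem map_pow_eq_of_eq_one {x : K} (hx : v x = 1) (k : ℕ) : v (x ^ k) = (k : WithTop ℤ) := by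
  rw [AddValuation.map_pow, hx, nsmul_one]

theorem pow_dvd_iff_of_mem_iff_nonneg
    (hO : ∀ h : K, (∃ o, algebraMap O K o = h) ↔ 0 ≤ v h) {π : O}
    (hπ : v (algebraMap O K π) = 1) (k : ℕ) (o : O) :
    π ^ k ∣ o ↔ (k : WithTop ℤ) ≤ v (algebraMap O K o) := by
  have hk : v (algebraMap O K (π ^ k)) = (k : WithTop ℤ) := by
    rw [map_pow, map_pow_eq_of_eq_one hπ]
  have hk0 : algebraMap O K (π ^ k) ≠ 0 := by
    intro h0
    rw [h0, AddValuation.map_zero] at hk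
    exact WithTop.natCast_ne_top k hk.symm
  constructor
  · rintro ⟨c, rfl⟩
    rw [map_mul, AddValuation.map_mul, hk]
    exact le_add_of_nonneg_right ((hO _).1 ⟨c, rfl⟩)
  · intro h
    obtain ⟨c, hc⟩ := (hO (algebraMap O K o / algebraMap O K (π ^ k))).2 (by
      have h1 : v (algebraMap O K o) =
          v (algebraMap O K o / algebraMap O K (π ^ k)) + (k : WithTop ℤ) := by
        rw [← hk, ← AddValuation.map_mul, div_mul_cancel₀ _ hk0]
      rw [h1] at h
      by_contra! h2
      refine absurd h (not_le_of_gt ?_)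
      calc _ < 0 + (k : WithTop ℤ) := WithTop.add_lt_add_right (WithTop.natCast_ne_top k) h2
        _ = k := zero_add _)
    refine ⟨c, FaithfulSMul.algebraMap_injective O K ?_⟩
    rw [map_mul, hc, mul_div_cancel₀ _ hk0]

theorem maximalIdeal_pow_eq_span [IsLocalRing O]
    (hO : ∀ h : K, (∃ o, algebraMap O K o = h) ↔ 0 ≤ v h) {π : O}
    (hπ : v (algebraMap O K π) = 1) (k : ℕ) :
    IsLocalRing.maximalIdeal O ^ k = Ideal.span {π ^ k} := by
  rw [← Ideal.span_singleton_pow]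
  congr 1
  ext o
  rw [IsLocalRing.mem_maximalIdeal, mem_nonunits_iff, isUnit_iff_of_mem_iff_nonneg hO,
    Ideal.mem_span_singleton]
  have h := pow_dvd_iff_of_mem_iff_nonneg hO hπ 1 o
  rw [pow_one] at h
  rw [h]
  -- Nonunits have nonzero value and multiples of `π` have value at least `1`; for nonnegative
  -- integers or `⊤` these conditions agree.
  have hnn : 0 ≤ v (algebraMap O K o) := (hO _).1 ⟨o, rfl⟩
  cases hv : v (algebraMap O K o) with
  | top => simp
  | coe z =>
    rw [hv] at hnn
    have h0 : (0 : WithTop ℤ) = ((0 : ℤ) : WithTop ℤ) := rfl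
    have h1 : ((1 : ℕ) : WithTop ℤ) = ((1 : ℤ) : WithTop ℤ) := rfl
    rw [h0, WithTop.coe_le_coe] at hnn
    rw [h0, h1, WithTop.coe_le_coe, WithTop.coe_inj]
    omega

theorem mem_maximalIdeal_pow_iff [IsLocalRing O]
    (hO : ∀ h : K, (∃ o, algebraMap O K o = h) ↔ 0 ≤ v h) {π : O}
    (hπ : v (algebraMap O K π) = 1) (k : ℕ) (o : O) :
    o ∈ IsLocalRing.maximalIdeal O ^ k ↔ (k : WithTop ℤ) ≤ v (algebraMap O K o) := by
  rw [maximalIdeal_pow_eq_span hO hπ, Ideal.mem_span_singleton,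
    pow_dvd_iff_of_mem_iff_nonneg hO hπ]

/-- An ideal of a discrete valuation ring is determined by the least value of its generators.
Uniqueness of the exponent holds because `π ^ l` has value exactly `l`. -/
theorem span_eq_maximalIdeal_pow_iff [IsLocalRing O]
    (hO : ∀ h : K, (∃ o, algebraMap O K o = h) ↔ 0 ≤ v h) {π : O}
    (hπ : v (algebraMap O K π) = 1) {s : Set O} {k : ℕ}
    (hs : ∀ o ∈ s, (k : WithTop ℤ) ≤ v (algebraMap O K o))
    (hk : ∃ o ∈ s, v (algebraMap O K o) = (k : WithTop ℤ)) (l : ℕ) :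
    Ideal.span s = IsLocalRing.maximalIdeal O ^ l ↔ l = k := by
  have key : Ideal.span s = IsLocalRing.maximalIdeal O ^ k := by
    refine le_antisymm (Ideal.span_le.2 fun o ho => (mem_maximalIdeal_pow_iff hO hπ k o).2 (hs o ho))
      ?_
    obtain ⟨o, ho, hov⟩ := hk
    rw [maximalIdeal_pow_eq_span hO hπ, Ideal.span_singleton_le_iff_mem]
    obtain ⟨c, rfl⟩ := (pow_dvd_iff_of_mem_iff_nonneg hO hπ k o).2 hov.ge
    have hc : IsUnit c := by
      rw [isUnit_iff_of_mem_iff_nonneg hO]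
      rw [map_mul, AddValuation.map_mul, map_pow, map_pow_eq_of_eq_one hπ] at hov
      refine (WithTop.add_right_inj (WithTop.natCast_ne_top k)).1 ?_
      rw [zero_add, add_comm, hov]
    exact (Ideal.mul_unit_mem_iff_mem _ hc).1 (Ideal.subset_span ho)
  rw [key]
  refine ⟨fun h => ?_, fun h => by rw [h]⟩
  have h1 := (mem_maximalIdeal_pow_iff hO hπ k (π ^ l)).1
    (h ▸ (mem_maximalIdeal_pow_iff hO hπ l (π ^ l)).2
      (by rw [map_pow, map_pow_eq_of_eq_one hπ]))
  have h2 := (mem_maximalIdeal_pow_iff hO hπ l (π ^ k)).1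
    (h ▸ (mem_maximalIdeal_pow_iff hO hπ k (π ^ k)).2
      (by rw [map_pow, map_pow_eq_of_eq_one hπ]))
  rw [map_pow, map_pow_eq_of_eq_one hπ] at h1 h2
  have h1' : k ≤ l := by exact_mod_cast h1
  have h2' : l ≤ k := by exact_mod_cast h2
  omega

end ValuationRing

/-! ### Generators of the image of the top forms. -/

section Forms

/-- The derivation is `ℂ`-linear and the characters span the algebra over `ℂ`, so their
differentials generate, also after base change. -/
theorem span_one_tmul_D_single {T : Type*} [AddCommMonoid T] (O : Type*)
    [CommRing O] [Algebra (AddMonoidAlgebra ℂ T) O] :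
    Submodule.span O (Set.range fun s : T => (1 : O) ⊗ₜ[AddMonoidAlgebra ℂ T]
      KaehlerDifferential.D ℂ (AddMonoidAlgebra ℂ T) (AddMonoidAlgebra.single s 1)) = ⊤ := by
  have h : Submodule.span (AddMonoidAlgebra ℂ T) (Set.range fun s : T =>
      KaehlerDifferential.D ℂ (AddMonoidAlgebra ℂ T) (AddMonoidAlgebra.single s 1)) = ⊤ := by
    rw [eq_top_iff, ← KaehlerDifferential.span_range_derivation, Submodule.span_le]
    rintro _ ⟨f, rfl⟩
    induction f using AddMonoidAlgebra.induction_linear with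
    | zero => simp
    | add f g hf hg =>
      rw [map_add]
      exact Submodule.add_mem _ hf hg
    | single s c =>
      have : (AddMonoidAlgebra.single s c : AddMonoidAlgebra ℂ T) =
          c • AddMonoidAlgebra.single s 1 := by simp
      rw [this, Derivation.map_smul]
      exact Submodule.smul_of_tower_mem _ c (Submodule.subset_span ⟨s, rfl⟩)
  have h2 := congrArg (Submodule.baseChange O) h
  rw [Submodule.baseChange_span, Submodule.baseChange_top, ← Set.range_comp] at h2
  exact h2

theorem imageOfForms_eq_span (n : ℕ) {T : Type u} [AddCommMonoid T] (O : Type u)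
    [CommRing O] [Algebra ℂ O] [Algebra (AddMonoidAlgebra ℂ T) O]
    [IsScalarTower ℂ (AddMonoidAlgebra ℂ T) O] :
    imageOfForms n (AddMonoidAlgebra ℂ T) O =
      Submodule.span O (Set.range fun x : Fin n → T =>
        exteriorPower.ιMulti O n fun i => KaehlerDifferential.D ℂ O
          (algebraMap (AddMonoidAlgebra ℂ T) O (AddMonoidAlgebra.single (x i) 1))) := by
  rw [imageOfForms, LinearMap.range_eq_map,
    ← exteriorPower.ιMulti_span_of_span O n _ (span_one_tmul_D_single (T := T) O),
    Submodule.map_span, Set.image_image]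
  congr 1
  ext w
  constructor
  · rintro ⟨a, ha, rfl⟩
    choose x hx using fun i => ha ⟨i, rfl⟩
    refine ⟨x, ?_⟩
    simp only [exteriorPower.map_apply_ιMulti]
    congr 1
    ext i
    rw [Function.comp_apply, ← hx i]
    simp
  · rintro ⟨x, rfl⟩
    refine ⟨fun i => 1 ⊗ₜ KaehlerDifferential.D ℂ _ (AddMonoidAlgebra.single (x i) 1), ?_, ?_⟩
    · rintro _ ⟨i, rfl⟩
      exact ⟨x i, rfl⟩
    · simp only [exteriorPower.map_apply_ιMulti]
      congr 1
      ext i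
      simp

/-- The top exterior power of a free module is free of rank one. -/
theorem exists_exteriorPower_equiv {O N : Type*} [CommRing O] [AddCommGroup N] [Module O N] {n : ℕ}
    (ω : Module.Basis (Fin n) O N) :
    ∃ E : (⋀[O]^n N) ≃ₗ[O] O, ∀ x, E (exteriorPower.ιMulti O n x) = ω.det x := by
  let δ : (⋀[O]^n N) →ₗ[O] O := exteriorPower.alternatingMapLinearEquiv ω.det
  let γ : O →ₗ[O] (⋀[O]^n N) := LinearMap.toSpanSingleton O _ (exteriorPower.ιMulti O n ω)
  have hδ : ∀ x, δ (exteriorPower.ιMulti O n x) = ω.det x := fun x => by simp [δ]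
  refine ⟨LinearEquiv.ofLinearMap δ γ ?_ ?_, hδ⟩
  · ext
    simp [γ, hδ, ω.det_self]
  -- An alternating map is determined by its values on injective families of basis vectors; these
  -- are permutations of `ω`, where only a sign has to be compared.
  · refine exteriorPower.linearMap_ext (Module.Basis.ext_alternating ω fun f hf => ?_)
    obtain ⟨p, rfl⟩ : ∃ p : Equiv.Perm (Fin n), ⇑p = f :=
      ⟨Equiv.ofBijective f (Finite.injective_iff_bijective.1 hf), rfl⟩
    have hω : (fun i => ω (p i)) = ω ∘ p := rfl
    simp [γ, hδ, hω, AlternatingMap.map_perm, ω.det_self]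

end Forms

/-! ### Differentials of the local ring of a toric divisor. -/

section KaehlerBasis

variable {M : Type u} [AddCommGroup M] {ι : Type*} [DecidableEq ι]
  (e : Module.Basis ι ℤ M) [Module.Free ℤ M] {S : AddSubmonoid M}
  {Φ : AddMonoidAlgebra ℂ M →ₐ[ℂ] FractionRing (CoordRing S)}
  {O : Type*} [CommRing O] [Algebra ℂ O] [Algebra O (FractionRing (CoordRing S))]
  [FaithfulSMul O (FractionRing (CoordRing S))]

/-- The partial logarithmic derivatives of characters. -/
theorem repr_D_eq
    {x : ι → O} {ω : Module.Basis ι O (KaehlerDifferential ℂ O)}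
    (hx : ∀ i, algebraMap O (FractionRing (CoordRing S)) (x i) =
      Φ (AddMonoidAlgebra.single (e i) 1))
    (hω : ∀ i, ω i = KaehlerDifferential.D ℂ O (x i)) (i : ι)
    {m : M} {u : O}
    (hu : algebraMap O (FractionRing (CoordRing S)) u = Φ (AddMonoidAlgebra.single m 1)) :
    algebraMap O (FractionRing (CoordRing S)) (ω.repr (KaehlerDifferential.D ℂ O u) i) =
      Φ (AddMonoidAlgebra.single m 1) * ((e.repr m i : ℤ) : FractionRing (CoordRing S)) *
        Φ (AddMonoidAlgebra.single (-e i) 1) := by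
  have hinj := FaithfulSMul.algebraMap_injective O (FractionRing (CoordRing S))
  let χ : M → FractionRing (CoordRing S) := fun m => Φ (AddMonoidAlgebra.single m 1)
  have hχadd : ∀ m m', χ (m + m') = χ m * χ m' := fun m m' => by
    simp only [χ]
    rw [← map_mul, AddMonoidAlgebra.single_mul_single, mul_one]
  have hχ0 : χ 0 = 1 := map_one Φ
  have hχne : ∀ m, χ m ≠ 0 := fun m h => by
    have := hχadd m (-m)
    rw [h, zero_mul, add_neg_cancel, hχ0] at this
    exact one_ne_zero this
  let d : O → FractionRing (CoordRing S) := fun u =>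
    algebraMap O (FractionRing (CoordRing S)) (ω.repr (KaehlerDifferential.D ℂ O u) i)
  have hdmul : ∀ u w : O, d (u * w) = algebraMap O _ u * d w + algebraMap O _ w * d u := by
    intro u w
    simp [d]
  -- Since `ω i = D (x i)`, the map `d` is the partial derivative along `x i`, and `P m` reads `x_i
  -- ∂_i χ^m = m_i χ^m`. It is inherited by sums through the Leibniz rule, as long as both
  -- characters lie in `O`.
  let P : M → Prop := fun m => ∀ u : O, algebraMap O (FractionRing (CoordRing S)) u = χ m →
    d u = χ m * ((e.repr m i : ℤ) : FractionRing (CoordRing S)) * χ (-e i)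
  have hPadd : ∀ (m m' : M) (u u' : O), algebraMap O (FractionRing (CoordRing S)) u = χ m →
      algebraMap O (FractionRing (CoordRing S)) u' = χ m' → P m → P m' → P (m + m') := by
    intro m m' u u' hu hu' hm hm' w hw
    have hw' : w = u * u' := hinj (by rw [hw, map_mul, hu, hu', hχadd])
    rw [hw', hdmul, hm u hu, hm' u' hu', hu, hu', hχadd, map_add, Finsupp.add_apply]
    push_cast
    ring
  have hPe : ∀ j, P (e j) := by
    intro j u hu
    have : u = x j := hinj (by rw [hu, hx])
    rw [this]
    simp only [d]
    rw [← hω, ω.repr_self, e.repr_self]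
    by_cases hij : j = i
    · subst hij
      simp [← hχadd, hχ0]
    · simp [hij]
  have hP0 : P 0 := by
    intro u hu
    have : u = 1 := hinj (by rw [hu, map_one, hχ0])
    simp [this, d]
  have hnat : ∀ l : ι →₀ ℕ, (∃ u, algebraMap O (FractionRing (CoordRing S)) u =
      χ (Finsupp.linearCombination ℕ e l)) ∧ P (Finsupp.linearCombination ℕ e l) := by
    intro l
    induction l using Finsupp.induction_linear with
    | zero => exact ⟨⟨1, by simp [hχ0]⟩, by simpa using hP0⟩
    | add f g hf hg =>
      obtain ⟨⟨u, hu⟩, hf⟩ := hf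
      obtain ⟨⟨w, hw⟩, hg⟩ := hg
      rw [map_add]
      exact ⟨⟨u * w, by rw [map_mul, hu, hw, hχadd]⟩, hPadd _ _ u w hu hw hf hg⟩
    | single j k =>
      rw [Finsupp.linearCombination_single]
      induction k with
      | zero => exact ⟨⟨1, by simp [hχ0]⟩, by simpa using hP0⟩
      | succ k ih =>
        obtain ⟨⟨u, hu⟩, h⟩ := ih
        rw [succ_nsmul]
        exact ⟨⟨u * x j, by rw [map_mul, hu, hx, hχadd]⟩, hPadd _ _ u (x j) hu (hx j) h (hPe j)⟩
  -- Negative exponents are cleared by writing `m + k = l` with natural combinations `k` and `l`.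
  -- The formulas for `k` and `l` then determine the derivative of `χ^m` by the Leibniz rule.
  let k : ι →₀ ℕ := (e.repr m).mapRange (fun z => (-z).toNat) (by simp)
  let l : ι →₀ ℕ := (e.repr m).mapRange Int.toNat (by simp)
  have hmkl : m + Finsupp.linearCombination ℕ e k = Finsupp.linearCombination ℕ e l := by
    apply e.repr.injective
    ext i
    rw [map_add, Finsupp.add_apply, repr_linearCombination_nat, repr_linearCombination_nat]
    simp only [k, l, Finsupp.mapRange_apply]
    omega
  obtain ⟨⟨w, hw⟩, hPk⟩ := hnat k
  have hPl := (hnat l).2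
  rw [← hmkl] at hPl
  have h1 := hPl (u * w) (by rw [map_mul, hu, hw, hχadd])
  rw [hdmul, hPk w hw, hw, hu, hχadd, map_add, Finsupp.add_apply] at h1
  refine mul_left_cancel₀ (hχne (Finsupp.linearCombination ℕ e k)) ?_
  push_cast at h1
  linear_combination h1

/-- A valuation ring of the function field that is the ring of the divisor of `b` has a free module
of differentials, with basis the differentials of the coordinates of an adapted basis. -/
theorem exists_basis_kaehlerDifferential [Fintype ι]
    [IsScalarTower ℂ O (FractionRing (CoordRing S))]
    (hS : ∀ m : M, ∃ t ∈ S, m + t ∈ S) (hΦinj : Function.Injective Φ)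
    (hΦ : ∀ f, Φ (toTorus S f) = algebraMap (CoordRing S) (FractionRing (CoordRing S)) f)
    {b : Module.Dual ℤ M} {i₀ : ι} (he : ∀ i, b (e i) = if i = i₀ then 1 else 0)
    (hO : ∀ h, (∃ o, algebraMap O (FractionRing (CoordRing S)) o = h) ↔ 0 ≤ toricValuation S b h) :
    ∃ (x : ι → O) (ω : Module.Basis ι O (KaehlerDifferential ℂ O)),
      (∀ i, algebraMap O (FractionRing (CoordRing S)) (x i) =
        Φ (AddMonoidAlgebra.single (e i) 1)) ∧
      ∀ i, ω i = KaehlerDifferential.D ℂ O (x i) := by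
  have hinj := FaithfulSMul.algebraMap_injective O (FractionRing (CoordRing S))
  let j : O →ₐ[ℂ] FractionRing (CoordRing S) := IsScalarTower.toAlgHom ℂ O _
  let θ : MvPolynomial ι ℂ →ₐ[ℂ] FractionRing (CoordRing S) := Φ.comp (toTorusOfBasis e)
  have hθinj : Function.Injective θ := hΦinj.comp (toTorusOfBasis_injective e)
  let θO : MvPolynomial ι ℂ →ₐ[ℂ] O :=
    ((AlgEquiv.ofInjective j hinj).symm : j.range →ₐ[ℂ] O).comp
      (θ.codRestrict j.range fun f =>
        (hO _).2 (toricValuation_toTorusOfBasis_nonneg e hS hΦ he f))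
  have hθO : ∀ f, algebraMap O (FractionRing (CoordRing S)) (θO f) = θ f := fun f =>
    congrArg Subtype.val ((AlgEquiv.ofInjective j hinj).apply_symm_apply _)
  -- The polynomials that do not vanish identically along the divisor; inverting them gives `O`.
  let T : Submonoid (MvPolynomial ι ℂ) :=
    { carrier := {g | toricValuation S b (θ g) = 0}
      one_mem' := by simp
      mul_mem' := fun {f g} hf hg => by
        change _ = _ at hf hg
        change _ = _
        rw [map_mul, AddValuation.map_mul, hf, hg, add_zero] }
  let : Algebra (MvPolynomial ι ℂ) O := θO.toRingHom.toAlgebra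
  have halg : ∀ f, algebraMap (MvPolynomial ι ℂ) O f = θO f := fun _ => rfl
  have : IsScalarTower ℂ (MvPolynomial ι ℂ) O :=
    .of_algebraMap_eq fun c => (θO.commutes c).symm
  have : IsLocalization T O :=
    { map_units := fun g => (isUnit_iff_of_mem_iff_nonneg hO _).2 (by
        rw [halg, hθO]
        exact g.2)
      surj := fun o => by
        obtain ⟨f, g, hfg, hg⟩ := exists_mul_eq_of_nonneg e hS hΦ he ((hO _).1 ⟨o, rfl⟩)
        refine ⟨(f, ⟨g, hg⟩), hinj ?_⟩
        rw [map_mul, halg, halg, hθO, hθO]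
        exact hfg.symm
      exists_of_eq := fun {f g} h => by
        refine ⟨1, ?_⟩
        have := congrArg (algebraMap O (FractionRing (CoordRing S))) h
        rw [halg, halg, hθO, hθO] at this
        rw [hθinj this] }
  -- Differentials commute with localization, so the basis of differentials of the polynomial ring
  -- carries over to `O`.
  have := KaehlerDifferential.isLocalizedModule_map ℂ (MvPolynomial ι ℂ) O T
  refine ⟨fun i => θO (MvPolynomial.X i),
    (KaehlerDifferential.mvPolynomialBasis ℂ ι).ofIsLocalizedModule O T
    (KaehlerDifferential.map ℂ ℂ (MvPolynomial ι ℂ) O), fun i => ?_, fun i => ?_⟩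
  · rw [hθO, ← toTorusOfBasis_X]
    rfl
  · rw [Module.Basis.ofIsLocalizedModule_apply, KaehlerDifferential.mvPolynomialBasis_apply,
      KaehlerDifferential.map_D, halg]

end KaehlerBasis

/-! ### The order of the image of the top forms. -/

section Core

variable {M : Type u} [AddCommGroup M] [Module.Free ℤ M] {S : AddSubmonoid M}
  {Φ : AddMonoidAlgebra ℂ M →ₐ[ℂ] FractionRing (CoordRing S)}
  {O : Type u} [CommRing O] [Algebra ℂ O] [Algebra O (FractionRing (CoordRing S))]
  [FaithfulSMul O (FractionRing (CoordRing S))]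

theorem toricValuation_algebraMap_complex {c : ℂ} (hc : c ≠ 0) (b : Module.Dual ℤ M) :
    toricValuation S b (algebraMap ℂ (FractionRing (CoordRing S)) c) = 0 := by
  rw [IsScalarTower.algebraMap_apply ℂ (CoordRing S), toricValuation_algebraMap, monomialOrder]
  have : algebraMap ℂ (CoordRing S) c = AddMonoidAlgebra.single 0 c := by
    simp
  rw [this, AddMonoidAlgebra.coeff_single, Finsupp.support_single _ hc]
  simp

open Classical in
-- By `repr_D_eq` the Jacobian matrix is the integer matrix of `m` with row `i` scaled by `χ^{-e_i}`
-- and column `j` by `χ^{m_j}`. The `-1` is `-∑ b(e_i)`. A nonzero integer determinant is a nonzero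
-- constant of `ℂ`, so it has value zero.
theorem toricValuation_det_D (hS : ∀ m : M, ∃ t ∈ S, m + t ∈ S)
    (hΦ : ∀ f, Φ (toTorus S f) = algebraMap (CoordRing S) (FractionRing (CoordRing S)) f)
    {n : ℕ} (e : Module.Basis (Fin n) ℤ M)
    {b : Module.Dual ℤ M} {i₀ : Fin n} (he : ∀ i, b (e i) = if i = i₀ then 1 else 0)
    {x : Fin n → O} {ω : Module.Basis (Fin n) O (KaehlerDifferential ℂ O)}
    (hx : ∀ i, algebraMap O (FractionRing (CoordRing S)) (x i) =
      Φ (AddMonoidAlgebra.single (e i) 1))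
    (hω : ∀ i, ω i = KaehlerDifferential.D ℂ O (x i))
    {m : Fin n → M} {u : Fin n → O}
    (hu : ∀ i, algebraMap O (FractionRing (CoordRing S)) (u i) =
      Φ (AddMonoidAlgebra.single (m i) 1)) :
    toricValuation S b (algebraMap O (FractionRing (CoordRing S))
      (ω.det fun i => KaehlerDifferential.D ℂ O (u i))) =
      if LinearIndependent ℤ m then ((∑ i, b (m i) - 1 : ℤ) : WithTop ℤ) else ⊤ := by
  have hdet : algebraMap O (FractionRing (CoordRing S))
      (ω.det fun i => KaehlerDifferential.D ℂ O (u i)) =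
      (∏ i, Φ (AddMonoidAlgebra.single (-e i) 1)) * ((∏ i, Φ (AddMonoidAlgebra.single (m i) 1)) *
        ((e.det m : ℤ) : FractionRing (CoordRing S))) := by
    have h1 : ((e.det m : ℤ) : FractionRing (CoordRing S)) =
        ((e.toMatrix m).map (Int.castRingHom (FractionRing (CoordRing S)))).det := by
      rw [Module.Basis.det_apply]
      exact RingHom.map_det (Int.castRingHom (FractionRing (CoordRing S))) (e.toMatrix m)
    rw [h1, Module.Basis.det_apply, RingHom.map_det, ← Matrix.det_mul_row, ← Matrix.det_mul_column]
    congr 1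
    ext i j
    simp only [RingHom.mapMatrix_apply, Matrix.map_apply, Matrix.of_apply,
      Module.Basis.toMatrix_apply]
    rw [repr_D_eq e hx hω i (hu j)]
    simp
    ring
  have hprod : ∀ f : Fin n → M, toricValuation S b (∏ i, Φ (AddMonoidAlgebra.single (f i) 1)) =
      ((∑ i, b (f i) : ℤ) : WithTop ℤ) := by
    intro f
    have : ∏ i, Φ (AddMonoidAlgebra.single (f i) 1) = Φ (AddMonoidAlgebra.single (∑ i, f i) 1) := by
      rw [← map_prod]
      congr 1
      simp
    rw [this, toricValuation_character hS hΦ b _ one_ne_zero, map_sum]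
  rw [hdet, AddValuation.map_mul, AddValuation.map_mul, hprod, hprod]
  split_ifs with hm
  · have h1 : ((e.det m : ℤ) : FractionRing (CoordRing S)) =
        algebraMap ℂ (FractionRing (CoordRing S)) ((e.det m : ℤ) : ℂ) := by simp
    rw [h1, toricValuation_algebraMap_complex (by
      simpa using (linearIndependent_iff_det_ne_zero e m).1 hm), add_zero, ← WithTop.coe_add]
    congr 1
    simp [he]
    ring
  · rw [linearIndependent_iff_det_ne_zero e, not_not] at hm
    simp [hm]

variable [Algebra (CoordRing S) O] [IsScalarTower ℂ (CoordRing S) O]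
  [IsScalarTower (CoordRing S) O (FractionRing (CoordRing S))]

/-- The image of the top forms of a toric variety in the top forms of the local ring of the toric
divisor of `b`. -/
theorem imageOfForms_eq_iff [Module.Finite ℤ M] [IsLocalRing O]
    (hS : ∀ m : M, ∃ t ∈ S, m + t ∈ S)
    {b : Module.Dual ℤ M} (hb : Function.Surjective b)
    (hO : ∀ h, (∃ o, algebraMap O (FractionRing (CoordRing S)) o = h) ↔ 0 ≤ toricValuation S b h)
    {k : ℕ} (hk : IsLeast {s : ℤ | ∃ x : Fin (Module.finrank ℤ M) → M, (∀ i, x i ∈ S) ∧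
      LinearIndependent ℤ x ∧ s = ∑ i, b (x i) - 1} k) (l : ℕ) :
    imageOfForms (Module.finrank ℤ M) (CoordRing S) O =
      IsLocalRing.maximalIdeal O ^ l •
        (⊤ : Submodule O (⋀[O]^(Module.finrank ℤ M) (KaehlerDifferential ℂ O))) ↔ l = k := by
  obtain ⟨Φ, hΦinj, hΦ⟩ := exists_torusHom hS
  obtain ⟨e, i₀, he⟩ := exists_adapted_basis hb
  have : IsScalarTower ℂ O (FractionRing (CoordRing S)) := .of_algebraMap_eq fun c => by
    rw [IsScalarTower.algebraMap_apply ℂ (CoordRing S) O, ← IsScalarTower.algebraMap_apply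
      (CoordRing S) O, ← IsScalarTower.algebraMap_apply]
  obtain ⟨x, ω, hx, hω⟩ := exists_basis_kaehlerDifferential e hS hΦinj hΦ he hO
  obtain ⟨E, hE⟩ := exists_exteriorPower_equiv ω
  have hval := fun m : Fin (Module.finrank ℤ M) → S => toricValuation_det_D hS hΦ e he hx hω
    (m := fun i => (m i : M))
    (u := fun i => algebraMap (CoordRing S) O (AddMonoidAlgebra.single (m i) 1)) fun i => by
      rw [← IsScalarTower.algebraMap_apply, ← hΦ, toTorus_single]
  have hπ : toricValuation S b (algebraMap O (FractionRing (CoordRing S)) (x i₀)) = 1 := by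
    rw [hx, toricValuation_character hS hΦ b _ one_ne_zero, he, if_pos rfl]
    rfl
  -- Transported by `E`, the claim becomes one about the ideal of `O` generated by the Jacobian
  -- determinants.
  rw [imageOfForms_eq_span, ← (Submodule.map_injective_of_injective E.injective).eq_iff,
    Submodule.map_span, Submodule.map_smul'', Submodule.map_top, LinearEquiv.range,
    Ideal.smul_top_eq_map, Algebra.algebraMap_self, Ideal.map_id, Submodule.restrictScalars_self,
    ← Set.range_comp]
  refine span_eq_maximalIdeal_pow_iff hO hπ ?_ ?_ l
  · rintro _ ⟨m, rfl⟩
    simp only [Function.comp_apply, LinearEquiv.coe_coe, hE]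
    rw [hval]
    split_ifs with hm
    · have := hk.2 ⟨_, fun i => (m i).2, hm, rfl⟩
      exact_mod_cast WithTop.coe_le_coe.2 this
    · exact le_top
  · obtain ⟨m, hmS, hm, hkm⟩ := hk.1
    refine ⟨_, ⟨fun i => ⟨m i, hmS i⟩, rfl⟩, ?_⟩
    simp only [Function.comp_apply, LinearEquiv.coe_coe, hE]
    rw [hval, if_pos hm, ← hkm]
    rfl

end Core

/-! ### Orders of vanishing and codimension-one points. -/

section Order

theorem isDiscreteValuationRing_of_isRegularLocalRing (O : Type*) [CommRing O] [IsDomain O]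
    [IsRegularLocalRing O] (h : ringKrullDim O = 1) : IsDiscreteValuationRing O := by
  have hf : ¬IsField O := fun hf => by
    rw [ringKrullDim_eq_zero_of_isField hf] at h
    exact zero_ne_one h
  refine ((IsDiscreteValuationRing.TFAE O hf).out 0 4).2 ?_
  have h1 := IsRegularLocalRing.spanFinrank_maximalIdeal (R := O)
  rw [h] at h1
  have h2 : (IsLocalRing.maximalIdeal O).spanFinrank = 1 := by exact_mod_cast h1
  have hfg : (IsLocalRing.maximalIdeal O).FG := (IsLocalRing.maximalIdeal O).fg_of_isNoetherianRing
  have h3 := Submodule.FG.generators_ncard hfg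
  rw [h2, Set.ncard_eq_one] at h3
  obtain ⟨x, hx⟩ := h3
  exact ⟨x, by rw [← hx, Submodule.span_generators]⟩

theorem stalk_mem_iff_ord_nonneg {Y : Scheme.{u}} [IsIntegral Y] [IsLocallyNoetherian Y] {y : Y}
    (hy : Order.coheight y = 1) [IsDiscreteValuationRing (Y.presheaf.stalk y)]
    {h : Y.functionField} (hh : h ≠ 0) :
    (∃ o, algebraMap (Y.presheaf.stalk y) Y.functionField o = h) ↔ 0 ≤ Scheme.ord h y := by
  have : Ring.KrullDimLE 1 (Y.presheaf.stalk y) := krullDimLE_of_coheight_le hy.le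
  rw [Scheme.le_ord_iff hy hh]
  change _ ↔ 1 ≤ Ring.ordFrac (Y.presheaf.stalk y) h
  constructor
  · rintro ⟨o, rfl⟩
    refine Ring.ordFrac_ge_one_of_ne_zero fun h0 => hh ?_
    rw [h0, map_zero]
  · intro h1
    obtain ⟨ϖ, hϖ⟩ := IsDiscreteValuationRing.exists_irreducible (Y.presheaf.stalk y)
    obtain ⟨z, w, rfl⟩ :=
      IsDiscreteValuationRing.exists_units_eq_smul_zpow_of_irreducible hϖ hh
    rw [Units.smul_def, Algebra.smul_def, map_mul, map_zpow₀, Ring.ordFrac_irreducible hϖ,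
      Ring.ordFrac_of_isUnit w.isUnit, one_mul, ← WithZero.exp_zsmul, ← WithZero.exp_zero,
      WithZero.exp_le_exp, smul_eq_mul, mul_one] at h1
    lift z to ℕ using h1
    exact ⟨w * ϖ ^ z, by simp [Units.smul_def, Algebra.smul_def]⟩

theorem exists_ord_eq_one {Y : Scheme.{u}} [IsIntegral Y] [IsLocallyNoetherian Y] {y : Y}
    (hy : Order.coheight y = 1) [IsDiscreteValuationRing (Y.presheaf.stalk y)] :
    ∃ h : Y.functionField, h ≠ 0 ∧ Scheme.ord h y = 1 := by
  have : Ring.KrullDimLE 1 (Y.presheaf.stalk y) := krullDimLE_of_coheight_le hy.le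
  obtain ⟨ϖ, hϖ⟩ := IsDiscreteValuationRing.exists_irreducible (Y.presheaf.stalk y)
  have h0 : algebraMap (Y.presheaf.stalk y) Y.functionField ϖ ≠ 0 := by
    simpa using hϖ.ne_zero
  exact ⟨_, h0, (Scheme.ord_eq_iff hy h0).2 (Ring.ordFrac_irreducible hϖ)⟩

/-- A point of an integral scheme whose local ring is the ring of a discrete valuation `v` has
codimension one, and `v` is the order of vanishing there. -/
theorem coheight_eq_one_and_ord_eq {Y : Scheme.{u}} [IsIntegral Y] [IsLocallyNoetherian Y] {y : Y}
    {v : AddValuation Y.functionField (WithTop ℤ)}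
    (hO : ∀ h, (∃ o, algebraMap (Y.presheaf.stalk y) Y.functionField o = h) ↔ 0 ≤ v h)
    {π : Y.functionField} (hπ : v π = 1) :
    Order.coheight y = 1 ∧ ∀ h, h ≠ 0 → v h = ((Scheme.ord h y : ℤ) : WithTop ℤ) := by
  obtain ⟨ϖ, rfl⟩ := (hO π).2 (hπ ▸ zero_le_one)
  have hm : IsLocalRing.maximalIdeal (Y.presheaf.stalk y) = Ideal.span {ϖ} := by
    have := maximalIdeal_pow_eq_span hO hπ 1
    rwa [pow_one, pow_one] at this
  have hϖ0 : ϖ ≠ 0 := by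
    rintro rfl
    rw [map_zero, AddValuation.map_zero] at hπ
    exact absurd hπ (by simp)
  have hf : ¬IsField (Y.presheaf.stalk y) := by
    rw [IsLocalRing.isField_iff_maximalIdeal_eq, hm, Ideal.span_singleton_eq_bot]
    exact hϖ0
  have hp : (IsLocalRing.maximalIdeal (Y.presheaf.stalk y)).IsPrincipal := ⟨ϖ, hm⟩
  have hdvr : IsDiscreteValuationRing (Y.presheaf.stalk y) :=
    ((IsDiscreteValuationRing.TFAE (Y.presheaf.stalk y) hf).out 0 4).2 hp
  have hy : Order.coheight y = 1 := by
    have h1 := ringKrullDim_stalk_eq_coheight y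
    rw [IsPrincipalIdealRing.ringKrullDim_eq_one _ hf] at h1
    exact_mod_cast h1.symm
  refine ⟨hy, fun h hh => ?_⟩
  have : Ring.KrullDimLE 1 (Y.presheaf.stalk y) := krullDimLE_of_coheight_le hy.le
  have hirr := (IsDiscreteValuationRing.irreducible_iff_uniformizer ϖ).2 hm
  obtain ⟨z, w, rfl⟩ := IsDiscreteValuationRing.exists_units_eq_smul_zpow_of_irreducible hirr hh
  have h1 : Scheme.ord (w • algebraMap (Y.presheaf.stalk y) Y.functionField ϖ ^ z) y = z := by
    rw [Scheme.ord_eq_iff hy hh]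
    change Ring.ordFrac (Y.presheaf.stalk y) _ = _
    rw [Units.smul_def, Algebra.smul_def, map_mul, map_zpow₀, Ring.ordFrac_irreducible hirr,
      Ring.ordFrac_of_isUnit w.isUnit, one_mul, ← WithZero.exp_zsmul, smul_eq_mul, mul_one]
    rfl
  rw [h1, Units.smul_def, Algebra.smul_def, AddValuation.map_mul,
    (isUnit_iff_of_mem_iff_nonneg hO _).1 w.isUnit, zero_add]
  have hnat : ∀ k : ℕ, v (algebraMap (Y.presheaf.stalk y) Y.functionField ϖ ^ k) =
      (((k : ℕ) : ℤ) : WithTop ℤ) := fun k => map_pow_eq_of_eq_one hπ k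
  obtain ⟨k, rfl | rfl⟩ := z.eq_nat_or_neg
  · rw [zpow_natCast, hnat]
  · have hne : algebraMap (Y.presheaf.stalk y) Y.functionField ϖ ^ k ≠ 0 :=
      pow_ne_zero _ (by simpa using hϖ0)
    have h2 := AddValuation.map_mul v
      (algebraMap (Y.presheaf.stalk y) Y.functionField ϖ ^ (-(k : ℤ)))
      (algebraMap (Y.presheaf.stalk y) Y.functionField ϖ ^ k)
    rw [zpow_neg, zpow_natCast, inv_mul_cancel₀ hne, AddValuation.map_one, hnat] at h2
    rw [zpow_neg, zpow_natCast]
    refine (WithTop.add_right_inj (z := (((k : ℕ) : ℤ) : WithTop ℤ)) WithTop.coe_ne_top).1 ?_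
    rw [← h2, ← WithTop.coe_add, neg_add_cancel]
    rfl

end Order

/-! ### Independence of the choice of model, divisor and multiplicity. -/

section Represents

theorem algebraMap_pullbackHom {A : Type u} [CommRing A] {Y : Scheme.{u}} [IsIntegral Y]
    (f : Y ⟶ Spec (CommRingCat.of A)) (y : Y) (x : A) :
    algebraMap (Y.presheaf.stalk y) Y.functionField (pullbackHom f y x) =
      pullbackHom f (genericPoint Y) x :=
  have : Nonempty (⊤ : Y.Opens) := ⟨⟨y, trivial⟩⟩
  Scheme.algebraMap_germ_eq_germToFunctionField Y (U := ⊤) trivial _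

theorem SmoothModel.pullbackField_algebraMap {A : Type u} [CommRing A] [IsDomain A]
    (W : SmoothModel A) (y : W.Y) (x : A) :
    W.pullbackField (algebraMap A (FractionRing A) x) =
      algebraMap (W.Y.presheaf.stalk y) W.Y.functionField (pullbackHom W.f y x) := by
  rw [algebraMap_pullbackHom]
  let := (pullbackHom W.f (genericPoint W.Y)).toAlgebra
  have : IsFractionRing A W.Y.functionField := W.birational
  exact (IsLocalization.algEquiv (nonZeroDivisors A) (FractionRing A) W.Y.functionField).commutes x

theorem SmoothModel.pullbackField_bijective {A : Type u} [CommRing A] [IsDomain A]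
    (W : SmoothModel A) : Function.Bijective W.pullbackField := by
  let := (pullbackHom W.f (genericPoint W.Y)).toAlgebra
  have : IsFractionRing A W.Y.functionField := W.birational
  exact (IsLocalization.algEquiv (nonZeroDivisors A) (FractionRing A) W.Y.functionField).bijective

theorem monomialOrder_nsmul {M : Type u} [AddCommGroup M] {S : AddSubmonoid M}
    (b : Module.Dual ℤ M) {k : ℕ} (hk : 0 < k) (g : CoordRing S) :
    monomialOrder S (k • b) g = k • monomialOrder S b g := by
  by_cases hg : g.coeff.support.Nonempty
  · rw [monomialOrder, monomialOrder, ← Finset.inf'_eq_inf hg, ← Finset.inf'_eq_inf hg,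
      Finset.apply_inf'_eq_inf'_comp hg (fun x : WithTop ℤ => k • x)]
    · refine Finset.inf'_congr hg rfl fun m _ => ?_
      simp [← WithTop.coe_nsmul]
    · intro x y
      exact (Monotone.map_inf (fun x y h => nsmul_le_nsmul_right h k) x y)
  · rw [Finset.not_nonempty_iff_eq_empty] at hg
    rw [monomialOrder, monomialOrder, hg, Finset.inf_empty, Finset.inf_empty]
    -- For `g = 0` both sides are `⊤`; this needs `k > 0`, because `0 • ⊤ = 0`.
    obtain ⟨k, rfl⟩ := Nat.exists_eq_succ_of_ne_zero hk.ne'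
    rw [succ_nsmul, WithTop.add_top]

variable {M : Type u} [AddCommGroup M] [Module.Free ℤ M] {S : AddSubmonoid M}

theorem toricValuation_nsmul (b : Module.Dual ℤ M) {k : ℕ} (hk : 0 < k)
    (h : FractionRing (CoordRing S)) :
    toricValuation S (k • b) h = k • toricValuation S b h := by
  obtain ⟨x, y, hy, rfl⟩ := IsFractionRing.div_surjective (A := CoordRing S) h
  have hy0 : y ≠ 0 := nonZeroDivisors.ne_zero hy
  have hyK : algebraMap (CoordRing S) (FractionRing (CoordRing S)) y ≠ 0 := by
    simpa using hy0
  have key : ∀ a : Module.Dual ℤ M, toricValuation S a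
      (algebraMap (CoordRing S) (FractionRing (CoordRing S)) x /
        algebraMap (CoordRing S) (FractionRing (CoordRing S)) y) + monomialOrder S a y =
      monomialOrder S a x := fun a => by
    rw [← toricValuation_algebraMap, ← toricValuation_algebraMap, ← AddValuation.map_mul,
      div_mul_cancel₀ _ hyK]
  have h1 := key (k • b)
  rw [monomialOrder_nsmul b hk, monomialOrder_nsmul b hk, ← key b, nsmul_add] at h1
  refine (WithTop.add_right_inj (z := k • monomialOrder S b y) ?_).1 h1
  rw [← monomialOrder_nsmul b hk]
  exact fun h => hy0 ((monomialAddVal_eq_top_iff S _ y).1 h)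

theorem SmoothModel.Represents.isDiscreteValuationRing {A : Type u} [CommRing A] [IsDomain A]
    {W : SmoothModel A} {v : AddValuation (FractionRing A) (WithTop ℤ)} {y : W.Y} {q : ℕ}
    (h : W.Represents v y q) : IsDiscreteValuationRing (W.Y.presheaf.stalk y) := by
  have := W.nonsingular y
  refine isDiscreteValuationRing_of_isRegularLocalRing _ ?_
  rw [ringKrullDim_stalk_eq_coheight, h.1]
  rfl

/-- The stalk is the valuation ring of `ord_E`, and a positive factor `q` does not change the
valuation ring. This is what removes the model from the computation. -/
theorem SmoothModel.Represents.mem_iff {A : Type u} [CommRing A] [IsDomain A]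
    {W : SmoothModel A} {v : AddValuation (FractionRing A) (WithTop ℤ)} {y : W.Y} {q : ℕ}
    (hW : W.Represents v y q) (h : FractionRing A) :
    (∃ o, algebraMap (W.Y.presheaf.stalk y) W.Y.functionField o = W.pullbackField h) ↔
      0 ≤ v h := by
  have := hW.isDiscreteValuationRing
  obtain ⟨hy, hq, hord⟩ := hW
  by_cases hh : h = 0
  · subst hh
    simp only [map_zero, AddValuation.map_zero, le_top, iff_true]
    exact ⟨0, map_zero _⟩
  rw [stalk_mem_iff_ord_nonneg hy ((map_ne_zero _).2 hh), hord h hh]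
  have h0 : (0 : WithTop ℤ) = ((0 : ℤ) : WithTop ℤ) := rfl
  have hq' : (0 : ℤ) < q := by exact_mod_cast hq
  rw [h0, WithTop.coe_le_coe, mul_nonneg_iff_of_pos_left hq']

/-- The value group is generated both by `q` and by `k`: a character with `b m = 1` has value `k`, a
multiple of `q`, while a uniformizer at `y` has value `q`, a multiple of `k`. -/
theorem SmoothModel.Represents.eq_of_eq_nsmul (hS : ∀ m : M, ∃ t ∈ S, m + t ∈ S)
    {W : SmoothModel (CoordRing S)} {b : Module.Dual ℤ M} (hb : Function.Surjective b)
    {k : ℕ} (hk : 0 < k) {y : W.Y} {q : ℕ} (hW : W.Represents (toricValuation S (k • b)) y q) :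
    q = k := by
  have := hW.isDiscreteValuationRing
  obtain ⟨hy, hq, hord⟩ := hW
  refine Nat.dvd_antisymm ?_ ?_
  · obtain ⟨Φ, hΦinj, hΦ⟩ := exists_torusHom hS
    obtain ⟨m, hm⟩ := hb 1
    have h0 : Φ (AddMonoidAlgebra.single m 1) ≠ 0 := by
      rw [map_ne_zero_iff _ hΦinj]
      simp
    have h1 := hord _ h0
    rw [toricValuation_character hS hΦ _ _ one_ne_zero, WithTop.coe_inj, LinearMap.smul_apply, hm,
      nsmul_one] at h1
    exact Int.natCast_dvd_natCast.1 ⟨_, by exact_mod_cast h1⟩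
  · obtain ⟨g, hg0, hg⟩ := exists_ord_eq_one hy
    obtain ⟨h, rfl⟩ := W.pullbackField_bijective.2 g
    have h0 : h ≠ 0 := (map_ne_zero _).1 hg0
    have h1 := hord h h0
    rw [hg, mul_one, toricValuation_nsmul b hk] at h1
    cases hv : toricValuation S b h with
    | top =>
      exact absurd ((AddValuation.top_iff _).1 hv) h0
    | coe z =>
      rw [hv, ← WithTop.coe_nsmul, WithTop.coe_inj, nsmul_eq_mul] at h1
      exact Int.natCast_dvd_natCast.1 ⟨z, h1.symm⟩

theorem SmoothModel.Represents.ordMatherEq_iff [Module.Finite ℤ M]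
    (hS : ∀ m : M, ∃ t ∈ S, m + t ∈ S)
    {W : SmoothModel (CoordRing S)} {b : Module.Dual ℤ M} (hb : Function.Surjective b)
    {k : ℕ} (hk : 0 < k) {y : W.Y} {q : ℕ} (hW : W.Represents (toricValuation S (k • b)) y q)
    {d : ℕ} (hd : IsLeast {s : ℤ | ∃ x : Fin (Module.finrank ℤ M) → M, (∀ i, x i ∈ S) ∧
      LinearIndependent ℤ x ∧ s = ∑ i, b (x i) - 1} d) (l : ℕ) :
    W.OrdMatherEq (Module.finrank ℤ M) y l ↔ l = d := by
  let : Algebra (CoordRing S) (W.Y.presheaf.stalk y) := (pullbackHom W.f y).toAlgebra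
  let : Algebra ℂ (W.Y.presheaf.stalk y) :=
    ((pullbackHom W.f y).comp (algebraMap ℂ (CoordRing S))).toAlgebra
  have : IsScalarTower ℂ (CoordRing S) (W.Y.presheaf.stalk y) := .of_algebraMap_eq' rfl
  let ρ : FractionRing (CoordRing S) ≃+* W.Y.functionField :=
    RingEquiv.ofBijective W.pullbackField W.pullbackField_bijective
  -- The stalk is embedded in the fraction field of `ℂ[S]` through the inverse of the birational
  -- identification; its image is the valuation ring of `b`.
  let : Algebra (W.Y.presheaf.stalk y) (FractionRing (CoordRing S)) :=
    ((ρ.symm : W.Y.functionField →+* FractionRing (CoordRing S)).comp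
      (algebraMap (W.Y.presheaf.stalk y) W.Y.functionField)).toAlgebra
  have hρ : ∀ o h, algebraMap (W.Y.presheaf.stalk y) (FractionRing (CoordRing S)) o = h ↔
      algebraMap (W.Y.presheaf.stalk y) W.Y.functionField o = W.pullbackField h :=
    fun o h => ρ.symm_apply_eq
  have : FaithfulSMul (W.Y.presheaf.stalk y) (FractionRing (CoordRing S)) :=
    (faithfulSMul_iff_algebraMap_injective _ _).2
      (ρ.symm.injective.comp (FaithfulSMul.algebraMap_injective _ _))
  have : IsScalarTower (CoordRing S) (W.Y.presheaf.stalk y) (FractionRing (CoordRing S)) :=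
    .of_algebraMap_eq fun x => ((hρ _ _).2 (W.pullbackField_algebraMap y x).symm).symm
  refine imageOfForms_eq_iff hS hb (fun h => ?_) hd l
  simp only [hρ]
  rw [hW.mem_iff, toricValuation_nsmul b hk]
  cases hv : toricValuation S b h with
  | top =>
    have : (0 : WithTop ℤ) ≤ k • ⊤ := nsmul_nonneg le_top k
    simpa using this
  | coe z =>
    have h0 : (0 : WithTop ℤ) = ((0 : ℤ) : WithTop ℤ) := rfl
    have hk' : (0 : ℤ) < k := by exact_mod_cast hk
    rw [← WithTop.coe_nsmul, h0, WithTop.coe_le_coe, WithTop.coe_le_coe, nsmul_eq_mul,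
      mul_nonneg_iff_of_pos_left hk']

end Represents

/-! ### Affine smooth models from regular overrings. -/

section AffineModel

theorem pullbackHom_specMap {A R : Type u} [CommRing A] [CommRing R] (φ : A →+* R)
    (y : Spec (CommRingCat.of R)) :
    pullbackHom (Spec.map (CommRingCat.ofHom φ)) y =
      (pullbackHom (𝟙 (Spec (CommRingCat.of R))) y).comp φ := by
  rw [pullbackHom, ← Scheme.ΓSpecIso_inv_naturality_assoc]
  rfl

theorem isLocalization_pullbackHom_id {R : Type u} [CommRing R] (y : PrimeSpectrum R) :
    letI := (pullbackHom (𝟙 (Spec (CommRingCat.of R))) y).toAlgebra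
    IsLocalization.AtPrime ((Spec (CommRingCat.of R)).presheaf.stalk y) y.asIdeal :=
  StructureSheaf.IsLocalization.to_stalk R y

theorem isFractionRing_pullbackHom_id {R : Type u} [CommRing R] [IsDomain R] :
    letI := (pullbackHom (𝟙 (Spec (CommRingCat.of R)))
      (genericPoint (Spec (CommRingCat.of R)))).toAlgebra
    IsFractionRing R (Spec (CommRingCat.of R)).functionField :=
  functionField_isFractionRing_of_affine (CommRingCat.of R)

theorem isRegularLocalRing_stalk_spec {R : Type u} [CommRing R] [IsRegularRing R]
    (y : PrimeSpectrum R) :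
    IsRegularLocalRing ((Spec (CommRingCat.of R)).presheaf.stalk y) := by
  let := (pullbackHom (𝟙 (Spec (CommRingCat.of R))) y).toAlgebra
  have := isLocalization_pullbackHom_id y
  exact IsRegularLocalRing.of_ringEquiv (IsLocalization.algEquiv y.asIdeal.primeCompl
    (Localization.AtPrime y.asIdeal) ((Spec (CommRingCat.of R)).presheaf.stalk y)).toRingEquiv

variable {A : Type u} [CommRing A] [IsDomain A] (R : Subring (FractionRing A))

theorem isFractionRing_of_range_le (hA : ∀ x, algebraMap A (FractionRing A) x ∈ R) :
    IsFractionRing R (FractionRing A) := by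
  refine IsFractionRing.of_field R (FractionRing A) fun z => ?_
  obtain ⟨x, y, -, rfl⟩ := IsFractionRing.div_surjective (A := A) z
  exact ⟨⟨_, hA x⟩, ⟨_, hA y⟩, rfl⟩

/-- The isomorphism of the function field of `A` with that of the spectrum of an overring of `A` in
its fraction field. -/
def overringFunctionFieldEquiv (hA : ∀ x, algebraMap A (FractionRing A) x ∈ R) :
    FractionRing A ≃+* (Spec (CommRingCat.of R)).functionField :=
  letI := (pullbackHom (𝟙 (Spec (CommRingCat.of R)))
      (genericPoint (Spec (CommRingCat.of R)))).toAlgebra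
  haveI : IsFractionRing R (Spec (CommRingCat.of R)).functionField := isFractionRing_pullbackHom_id
  haveI := isFractionRing_of_range_le R hA
  (IsLocalization.algEquiv (nonZeroDivisors R) (FractionRing A)
    (Spec (CommRingCat.of R)).functionField).toRingEquiv

theorem overringFunctionFieldEquiv_coe (hA : ∀ x, algebraMap A (FractionRing A) x ∈ R) (r : R) :
    overringFunctionFieldEquiv R hA r = pullbackHom (𝟙 (Spec (CommRingCat.of R)))
      (genericPoint (Spec (CommRingCat.of R))) r := by
  let := (pullbackHom (𝟙 (Spec (CommRingCat.of R)))
      (genericPoint (Spec (CommRingCat.of R)))).toAlgebra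
  have : IsFractionRing R (Spec (CommRingCat.of R)).functionField := isFractionRing_pullbackHom_id
  have := isFractionRing_of_range_le R hA
  exact (IsLocalization.algEquiv (nonZeroDivisors R) (FractionRing A)
    (Spec (CommRingCat.of R)).functionField).commutes r

/-- The spectrum of a regular overring of `A` of finite type in its fraction field. -/
def overringModel [IsRegularRing R] (hA : ∀ x, algebraMap A (FractionRing A) x ∈ R)
    (hft : ((algebraMap A (FractionRing A)).codRestrict R hA).FiniteType) : SmoothModel A where
  Y := Spec (CommRingCat.of R)
  f := Spec.map (CommRingCat.ofHom ((algebraMap A (FractionRing A)).codRestrict R hA))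
  isIntegral := inferInstance
  isLocallyNoetherian := inferInstance
  isSeparated := inferInstance
  quasiCompact := inferInstance
  locallyOfFiniteType := by rwa [HasRingHomProperty.Spec_iff (P := @LocallyOfFiniteType)]
  nonsingular := isRegularLocalRing_stalk_spec
  birational := by
    let := (pullbackHom (Spec.map (CommRingCat.ofHom
      ((algebraMap A (FractionRing A)).codRestrict R hA)))
        (genericPoint (Spec (CommRingCat.of R)))).toAlgebra
    let e : FractionRing A ≃ₐ[A] (Spec (CommRingCat.of R)).functionField :=
      AlgEquiv.ofRingEquiv (f := overringFunctionFieldEquiv R hA) fun x => by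
        rw [RingHom.algebraMap_toAlgebra, pullbackHom_specMap]
        exact overringFunctionFieldEquiv_coe R hA ⟨_, hA x⟩
    exact IsLocalization.isLocalization_of_algEquiv _ e

theorem pullbackField_overringModel [IsRegularRing R]
    (hA : ∀ x, algebraMap A (FractionRing A) x ∈ R)
    (hft : ((algebraMap A (FractionRing A)).codRestrict R hA).FiniteType) (h : FractionRing A) :
    (overringModel R hA hft).pullbackField h = overringFunctionFieldEquiv R hA h := by
  have key : ∀ x : A, (overringModel R hA hft).pullbackField (algebraMap A (FractionRing A) x) =
      overringFunctionFieldEquiv R hA (algebraMap A (FractionRing A) x) := fun x => by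
    rw [SmoothModel.pullbackField_algebraMap _ (genericPoint _), algebraMap_pullbackHom]
    refine (congrFun (congrArg DFunLike.coe (pullbackHom_specMap
      ((algebraMap A (FractionRing A)).codRestrict R hA) _)) x).trans ?_
    exact (overringFunctionFieldEquiv_coe R hA ⟨_, hA x⟩).symm
  obtain ⟨x, y, hy, rfl⟩ := IsFractionRing.div_surjective (A := A) h
  rw [map_div₀, map_div₀, key, key]
  rfl

/-- A valuation whose ring is a localization of a regular overring of `A` of finite type is the order
of vanishing along a prime divisor. -/
theorem exists_smoothModel_ord_eq [IsRegularRing R]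
    (hA : ∀ x, algebraMap A (FractionRing A) x ∈ R)
    (hft : ((algebraMap A (FractionRing A)).codRestrict R hA).FiniteType)
    {v : AddValuation (FractionRing A) (WithTop ℤ)} (hv : ∀ r ∈ R, 0 ≤ v r)
    (hfrac : ∀ h, 0 ≤ v h → ∃ f ∈ R, ∃ g ∈ R, f = h * g ∧ v g = 0)
    {π : FractionRing A} (hπ : v π = 1) :
    ∃ (W : SmoothModel A) (y : W.Y), Order.coheight y = 1 ∧
      ∀ h, h ≠ 0 → v h = ((Scheme.ord (W.pullbackField h) y : ℤ) : WithTop ℤ) := by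
  let W := overringModel R hA hft
  -- The centre of `v` on the spectrum of `R`. The point `y` below is this prime, and `hO`
  -- identifies its local ring with the valuation ring of `v`.
  let 𝔭 : Ideal R :=
    { carrier := {r | 0 < v r}
      zero_mem' := by simp
      add_mem' := fun {r s} hr hs => (lt_min hr hs).trans_le (AddValuation.map_add v r s)
      smul_mem' := fun r s hs => by
        change 0 < v ((r : FractionRing A) * s)
        rw [AddValuation.map_mul]
        exact lt_of_lt_of_le hs (le_add_of_nonneg_left (hv r r.2)) }
  have h𝔭 : 𝔭.IsPrime := by
    refine ⟨fun h => ?_, fun {r s} hrs => ?_⟩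
    · have h1 : (0 : WithTop ℤ) < v (1 : FractionRing A) := (Ideal.eq_top_iff_one 𝔭).1 h
      simp at h1
    · by_contra! h
      have hr : ¬ 0 < v (r : FractionRing A) := h.1
      have hs : ¬ 0 < v (s : FractionRing A) := h.2
      have hrs : 0 < v ((r : FractionRing A) * s) := hrs
      rw [AddValuation.map_mul, le_antisymm (not_lt.1 hr) (hv r r.2),
        le_antisymm (not_lt.1 hs) (hv s s.2)] at hrs
      simp at hrs
  have hmem : ∀ r : R, r ∉ 𝔭 ↔ v (r : FractionRing A) = 0 := fun r =>
    ⟨fun h => le_antisymm (not_lt.1 h) (hv r r.2), fun h (h' : 0 < v (r : FractionRing A)) => h'.ne' h⟩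
  let y : Spec (CommRingCat.of R) := (⟨𝔭, h𝔭⟩ : PrimeSpectrum R)
  let ρ := overringFunctionFieldEquiv R hA
  have hρ : ∀ h, W.pullbackField h = ρ h := pullbackField_overringModel R hA hft
  let w : AddValuation (Spec (CommRingCat.of R)).functionField (WithTop ℤ) := v.comap ρ.symm
  have hw : ∀ h, w (ρ h) = v h := fun h => congrArg v (ρ.symm_apply_apply h)
  let := (pullbackHom (𝟙 (Spec (CommRingCat.of R))) y).toAlgebra
  have : IsLocalization.AtPrime ((Spec (CommRingCat.of R)).presheaf.stalk y) y.asIdeal :=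
    isLocalization_pullbackHom_id y
  have halg : ∀ r : R, algebraMap ((Spec (CommRingCat.of R)).presheaf.stalk y)
      (Spec (CommRingCat.of R)).functionField (algebraMap R _ r) = ρ r := fun r => by
    rw [overringFunctionFieldEquiv_coe]
    exact algebraMap_pullbackHom _ _ _
  have hO : ∀ h, (∃ o, algebraMap ((Spec (CommRingCat.of R)).presheaf.stalk y)
      (Spec (CommRingCat.of R)).functionField o = h) ↔ 0 ≤ w h := by
    intro h
    obtain ⟨h, rfl⟩ := ρ.surjective h
    rw [hw]
    constructor
    · rintro ⟨o, ho⟩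
      obtain ⟨⟨r, s⟩, hrs⟩ := IsLocalization.surj y.asIdeal.primeCompl o
      have h1 := congrArg (algebraMap ((Spec (CommRingCat.of R)).presheaf.stalk y)
        (Spec (CommRingCat.of R)).functionField) hrs
      have ho' : algebraMap ((Spec (CommRingCat.of R)).presheaf.stalk y)
        (Spec (CommRingCat.of R)).functionField o = ρ h := ho
      rw [map_mul, halg, halg, ho', ← map_mul] at h1
      have h2 := congrArg v (ρ.injective h1)
      rw [AddValuation.map_mul, (hmem s).1 s.2, add_zero] at h2
      rw [h2]
      exact hv r r.2
    · intro hh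
      obtain ⟨f, hf, g, hg, hfg, hg0⟩ := hfrac h hh
      have hg' : (⟨g, hg⟩ : R) ∈ y.asIdeal.primeCompl := (hmem ⟨g, hg⟩).2 hg0
      refine ⟨IsLocalization.mk' ((Spec (CommRingCat.of R)).presheaf.stalk y) (⟨f, hf⟩ : R)
        (⟨_, hg'⟩ : y.asIdeal.primeCompl), ?_⟩
      have h1 := congrArg (algebraMap ((Spec (CommRingCat.of R)).presheaf.stalk y)
        (Spec (CommRingCat.of R)).functionField) (IsLocalization.mk'_spec
          ((Spec (CommRingCat.of R)).presheaf.stalk y) (⟨f, hf⟩ : R)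
        (⟨_, hg'⟩ : y.asIdeal.primeCompl))
      rw [map_mul, halg, halg] at h1
      have hgne : ρ g ≠ 0 := by
        rw [map_ne_zero]
        rintro rfl
        rw [AddValuation.map_zero] at hg0
        exact WithTop.top_ne_zero hg0
      refine mul_right_cancel₀ hgne (h1.trans ?_)
      rw [← map_mul, ← hfg]
  obtain ⟨hy, hord⟩ := coheight_eq_one_and_ord_eq hO (π := ρ π) ((hw π).trans hπ)
  refine ⟨W, y, hy, fun h hh => ?_⟩
  rw [hρ, ← hw]
  exact hord (ρ h) ((map_ne_zero ρ).2 hh)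

end AffineModel

/-! ### A smooth model carrying the toric divisor, and existence of the minimum. -/

section ToricModel

/-- A local ring of `R` is the local ring of `P` at the contracted prime. -/
theorem isRegularRing_of_isLocalization {P R : Type*} [CommRing P] [CommRing R] [Algebra P R]
    (T : Submonoid P) [IsLocalization T R] [IsRegularRing P] : IsRegularRing R := by
  have : IsNoetherianRing R := IsLocalization.isNoetherianRing T R inferInstance
  refine isRegularRing_iff.2 fun p _ => ?_
  have := IsLocalization.isLocalization_isLocalization_atPrime_isLocalization T
    (Localization.AtPrime p) p
  exact IsRegularLocalRing.of_ringEquiv (IsLocalization.algEquiv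
    (p.comap (algebraMap P R)).primeCompl (Localization.AtPrime (p.comap (algebraMap P R)))
    (Localization.AtPrime p)).toRingEquiv

variable {M : Type u} [AddCommGroup M] {ι : Type*} [DecidableEq ι]
  (e : Module.Basis ι ℤ M) {S : AddSubmonoid M}
  (Φ : AddMonoidAlgebra ℂ M →ₐ[ℂ] FractionRing (CoordRing S)) (b : Module.Dual ℤ M)

/-- The coordinate ring of the partial compactification of the torus by the divisor of `b`. -/
def divisorRing : Subalgebra ℂ (FractionRing (CoordRing S)) :=
  Algebra.adjoin ℂ {h | ∃ m : M, 0 ≤ b m ∧ Φ (AddMonoidAlgebra.single m 1) = h}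

variable {b}

theorem character_mem_divisorRing {m : M} (hm : 0 ≤ b m) :
    Φ (AddMonoidAlgebra.single m 1) ∈ divisorRing Φ b :=
  Algebra.subset_adjoin ⟨m, hm, rfl⟩

theorem toTorusOfBasis_mem_divisorRing {i₀ : ι} (he : ∀ i, b (e i) = if i = i₀ then 1 else 0)
    (f : MvPolynomial ι ℂ) : Φ (toTorusOfBasis e f) ∈ divisorRing Φ b := by
  induction f using MvPolynomial.induction_on with
  | C a =>
    rw [← MvPolynomial.algebraMap_eq, AlgHom.commutes, AlgHom.commutes]
    exact Subalgebra.algebraMap_mem _ a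
  | add p q hp hq =>
    rw [map_add, map_add]
    exact add_mem hp hq
  | mul_X p i hp =>
    rw [map_mul, map_mul, toTorusOfBasis_X]
    refine mul_mem hp (character_mem_divisorRing Φ ?_)
    rw [he]
    split_ifs <;> norm_num

variable {Φ}

theorem algebraMap_mem_divisorRing
    (hΦ : ∀ f, Φ (toTorus S f) = algebraMap (CoordRing S) (FractionRing (CoordRing S)) f)
    (hb : ∀ m ∈ S, 0 ≤ b m) (f : CoordRing S) :
    algebraMap (CoordRing S) (FractionRing (CoordRing S)) f ∈ divisorRing Φ b := by
  rw [← hΦ]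
  induction f using AddMonoidAlgebra.induction_linear with
  | zero => simp
  | add f g hf hg =>
    rw [map_add, map_add]
    exact add_mem hf hg
  | single s c =>
    have : (AddMonoidAlgebra.single (s : M) c : AddMonoidAlgebra ℂ M) =
        c • AddMonoidAlgebra.single (s : M) 1 := by simp
    rw [toTorus_single, this, map_smul]
    exact Subalgebra.smul_mem _ (character_mem_divisorRing Φ (hb s s.2)) c

/-- The ring of the divisor of `b` is a localization of a polynomial ring. -/
theorem exists_isLocalization_away_divisorRing [Fintype ι] (hΦinj : Function.Injective Φ)
    {i₀ : ι} (he : ∀ i, b (e i) = if i = i₀ then 1 else 0) :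
    ∃ (_ : Algebra (MvPolynomial ι ℂ) (divisorRing Φ b)) (w : MvPolynomial ι ℂ),
      IsScalarTower ℂ (MvPolynomial ι ℂ) (divisorRing Φ b) ∧
      IsLocalization.Away w (divisorRing Φ b) := by
  let θ : MvPolynomial ι ℂ →ₐ[ℂ] divisorRing Φ b :=
    (Φ.comp (toTorusOfBasis e)).codRestrict _ (toTorusOfBasis_mem_divisorRing e Φ he)
  let alg : Algebra (MvPolynomial ι ℂ) (divisorRing Φ b) := θ.toRingHom.toAlgebra
  have halg : ∀ f, (algebraMap (MvPolynomial ι ℂ) (divisorRing Φ b) f :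
      FractionRing (CoordRing S)) = Φ (toTorusOfBasis e f) := fun _ => rfl
  -- The monomial `w` is the product of the coordinates other than `x_{i₀}`. Its character lies in
  -- the kernel of `b`, so its inverse also belongs to the ring.
  let α : ι →₀ ℕ := Finsupp.equivFunOnFinite.symm fun i => if i = i₀ then 0 else 1
  let w : MvPolynomial ι ℂ := MvPolynomial.monomial α 1
  have hw : ∀ N : ℕ, toTorusOfBasis e (w ^ N) =
      AddMonoidAlgebra.single (N • Finsupp.linearCombination ℕ e α) 1 := fun N => by
    rw [MvPolynomial.monomial_pow, toTorusOfBasis_monomial, one_pow, map_nsmul]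
  have hsurj : ∀ r ∈ divisorRing Φ b, ∃ (N : ℕ) (f : MvPolynomial ι ℂ),
      r * Φ (toTorusOfBasis e (w ^ N)) = Φ (toTorusOfBasis e f) := by
    intro r hr
    induction hr using Algebra.adjoin_induction with
    | mem x hx =>
      obtain ⟨m, hm, rfl⟩ := hx
      -- `w ^ N` clears the negative exponents away from `i₀`; at `i₀` the exponent is `b m`,
      -- already nonnegative.
      let N : ℕ := ∑ i, (e.repr m i).natAbs
      obtain ⟨f, hf⟩ := exists_toTorusOfBasis_eq_single e
        (m := m + N • Finsupp.linearCombination ℕ e α) (fun i => by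
          rw [← map_nsmul, map_add, Finsupp.add_apply, repr_linearCombination_nat]
          simp only [Finsupp.smul_apply, α, Finsupp.equivFunOnFinite_symm_apply_apply, smul_eq_mul]
          split_ifs with hi
          · rw [hi, repr_eq_apply_of_adapted e he]
            simpa using hm
          · have : (e.repr m i).natAbs ≤ N :=
              Finset.single_le_sum (f := fun i => (e.repr m i).natAbs) (fun _ _ => Nat.zero_le _)
                (Finset.mem_univ i)
            omega) 1
      exact ⟨N, f, by rw [hf, hw, ← map_mul, AddMonoidAlgebra.single_mul_single, mul_one]⟩
    | algebraMap c =>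
      refine ⟨0, algebraMap _ _ c, ?_⟩
      rw [pow_zero, map_one, map_one, mul_one, AlgHom.commutes, AlgHom.commutes]
    | add x y _ _ hx hy =>
      obtain ⟨N, f, hf⟩ := hx
      obtain ⟨N', f', hf'⟩ := hy
      refine ⟨N + N', f * w ^ N' + f' * w ^ N, ?_⟩
      simp only [pow_add, map_add, map_mul, ← hf, ← hf']
      ring
    | mul x y _ _ hx hy =>
      obtain ⟨N, f, hf⟩ := hx
      obtain ⟨N', f', hf'⟩ := hy
      refine ⟨N + N', f * f', ?_⟩
      simp only [pow_add, map_mul, ← hf, ← hf']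
      ring
  have hwu : IsUnit (algebraMap (MvPolynomial ι ℂ) (divisorRing Φ b) w) := by
    have hb0 : b (Finsupp.linearCombination ℕ e α) = 0 := by
      rw [← repr_eq_apply_of_adapted e he, repr_linearCombination_nat]
      simp [α]
    refine IsUnit.of_mul_eq_one ⟨Φ (AddMonoidAlgebra.single
      (-Finsupp.linearCombination ℕ e α) 1), character_mem_divisorRing Φ (by simp [hb0])⟩
      (Subtype.ext ?_)
    have h1 := hw 1
    rw [pow_one, one_smul] at h1
    rw [MulMemClass.coe_mul, halg, h1, ← map_mul, AddMonoidAlgebra.single_mul_single,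
      add_neg_cancel, mul_one]
    exact map_one Φ
  refine ⟨alg, w, .of_algebraMap_eq fun c => (θ.commutes c).symm,
    { map_units := ?_, surj := fun r => ?_, exists_of_eq := fun {f g} h => ⟨1, ?_⟩ }⟩
  · rintro ⟨_, N, rfl⟩
    simp only [map_pow]
    exact hwu.pow N
  · obtain ⟨N, f, hf⟩ := hsurj r r.2
    exact ⟨(f, ⟨w ^ N, N, rfl⟩), Subtype.ext hf⟩
  · have h1 : Φ (toTorusOfBasis e f) = Φ (toTorusOfBasis e g) := congrArg Subtype.val h
    rw [toTorusOfBasis_injective e (hΦinj h1)]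

variable [Module.Free ℤ M]

theorem toricValuation_nonneg_of_mem_divisorRing (hS : ∀ m : M, ∃ t ∈ S, m + t ∈ S)
    (hΦ : ∀ f, Φ (toTorus S f) = algebraMap (CoordRing S) (FractionRing (CoordRing S)) f)
    {r : FractionRing (CoordRing S)} (hr : r ∈ divisorRing Φ b) : 0 ≤ toricValuation S b r := by
  induction hr using Algebra.adjoin_induction with
  | mem x hx =>
    obtain ⟨m, hm, rfl⟩ := hx
    rw [toricValuation_character hS hΦ b m one_ne_zero]
    exact WithTop.coe_le_coe.2 hm
  | algebraMap c =>
    by_cases hc : c = 0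
    · simp [hc]
    · rw [toricValuation_algebraMap_complex hc]
  | add x y _ _ hx hy => exact (le_min hx hy).trans (AddValuation.map_add _ _ _)
  | mul x y _ _ hx hy =>
    rw [AddValuation.map_mul]
    exact add_nonneg hx hy

/-- The model is the spectrum of `divisorRing Φ b`. This ring contains `ℂ[S]` because `b ≥ 0` on
`S`, is regular as a localization of a polynomial ring, and is of finite type over `ℂ[S]` because it
already is over `ℂ`. -/
theorem exists_represents_toricValuation [Module.Finite ℤ M] (hS : ∀ m : M, ∃ t ∈ S, m + t ∈ S)
    (hbS : ∀ m ∈ S, 0 ≤ b m) (hb : Function.Surjective b) {k : ℕ} (hk : 0 < k) :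
    ∃ (W : SmoothModel (CoordRing S)) (y : W.Y), W.Represents (toricValuation S (k • b)) y k := by
  obtain ⟨Φ, hΦinj, hΦ⟩ := exists_torusHom hS
  obtain ⟨e, i₀, he⟩ := exists_adapted_basis hb
  obtain ⟨alg, w, htower, haway⟩ := exists_isLocalization_away_divisorRing e hΦinj he
  have hreg : IsRegularRing (divisorRing Φ b).toSubring :=
    isRegularRing_of_isLocalization (R := divisorRing Φ b) (Submonoid.powers w)
  have hft : Algebra.FiniteType ℂ (divisorRing Φ b) := by
    have : Algebra.FiniteType (MvPolynomial (Fin (Module.finrank ℤ M)) ℂ) (divisorRing Φ b) :=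
      IsLocalization.finiteType_of_monoid_fg (Submonoid.powers w) _
    exact Algebra.FiniteType.trans (S := MvPolynomial (Fin (Module.finrank ℤ M)) ℂ)
      inferInstance inferInstance
  have hA := algebraMap_mem_divisorRing (Φ := Φ) hΦ hbS
  have hft' : ((algebraMap (CoordRing S) (FractionRing (CoordRing S))).codRestrict
      (divisorRing Φ b).toSubring hA).FiniteType := by
    refine RingHom.FiniteType.of_comp_finiteType (f := algebraMap ℂ (CoordRing S)) ?_
    let g : ℂ →+* divisorRing Φ b := ((algebraMap (CoordRing S) (FractionRing
      (CoordRing S))).codRestrict (divisorRing Φ b).toSubring hA).comp (algebraMap ℂ (CoordRing S))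
    have hg : g = algebraMap ℂ (divisorRing Φ b) := RingHom.ext fun c => Subtype.ext
      (IsScalarTower.algebraMap_apply ℂ (CoordRing S) (FractionRing (CoordRing S)) c).symm
    have : g.FiniteType := hg ▸ RingHom.finiteType_algebraMap.2 hft
    exact this
  obtain ⟨m, hm⟩ := hb 1
  obtain ⟨W, y, hy, hord⟩ := exists_smoothModel_ord_eq (divisorRing Φ b).toSubring hA hft'
    (v := toricValuation S b) (π := Φ (AddMonoidAlgebra.single m 1))
    (fun r hr => toricValuation_nonneg_of_mem_divisorRing hS hΦ hr)
    (fun h hh => by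
      obtain ⟨f, g, hfg, hg⟩ := exists_mul_eq_of_nonneg e hS hΦ he hh
      exact ⟨_, toTorusOfBasis_mem_divisorRing e Φ he f, _,
        toTorusOfBasis_mem_divisorRing e Φ he g, hfg, hg⟩)
    (by rw [toricValuation_character hS hΦ b m one_ne_zero, hm]; rfl)
  refine ⟨W, y, hy, hk, fun h hh => ?_⟩
  rw [toricValuation_nsmul b hk, hord h hh, ← WithTop.coe_nsmul, nsmul_eq_mul]

/-- The sums are bounded below by `1`: they are nonnegative, and if every `b (x i)` were zero, row
`i₀` of the coordinate matrix would vanish, against independence. -/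
theorem exists_isLeast_sum_sub_one [Module.Finite ℤ M] (hS : ∀ m : M, ∃ t ∈ S, m + t ∈ S)
    (hbS : ∀ m ∈ S, 0 ≤ b m) (hb : Function.Surjective b) :
    ∃ d : ℕ, IsLeast {s : ℤ | ∃ x : Fin (Module.finrank ℤ M) → M, (∀ i, x i ∈ S) ∧
      LinearIndependent ℤ x ∧ s = ∑ i, b (x i) - 1} d := by
  obtain ⟨e, i₀, he⟩ := exists_adapted_basis hb
  have hnn : ∀ s : ℤ, (∃ x : Fin (Module.finrank ℤ M) → M, (∀ i, x i ∈ S) ∧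
      LinearIndependent ℤ x ∧ s = ∑ i, b (x i) - 1) → 0 ≤ s := by
    rintro _ ⟨x, hxS, hx, rfl⟩
    have h1 : 0 ≤ ∑ i, b (x i) := Finset.sum_nonneg fun i _ => hbS _ (hxS i)
    have h2 : ∑ i, b (x i) ≠ 0 := by
      intro h0
      rw [Finset.sum_eq_zero_iff_of_nonneg fun i _ => hbS _ (hxS i)] at h0
      rw [linearIndependent_iff_det_ne_zero e, Module.Basis.det_apply] at hx
      refine hx (Matrix.det_eq_zero_of_row_eq_zero i₀ fun j => ?_)
      rw [Module.Basis.toMatrix_apply, repr_eq_apply_of_adapted e he, h0 j (Finset.mem_univ j)]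
    omega
  obtain ⟨x, hxS, hx⟩ := exists_linearIndependent_mem hS
  obtain ⟨d, hd, hmin⟩ := Int.exists_least_of_bdd ⟨0, hnn⟩ ⟨_, x, hxS, hx, rfl⟩
  lift d to ℕ using hnn d hd
  exact ⟨d, hd, fun s hs => hmin s hs⟩

end ToricModel

end ToricMather

end

/-! ### Passage from the primitive functional to its multiple. -/

theorem mainTheorem10 {M : Type u} [AddCommGroup M] [Module.Free ℤ M] [Module.Finite ℤ M]
    (σ : PointedCone ℝ (ToricMather.DualSpace M))
    (hσ_rat : ToricMather.IsRationalPolyhedral σ)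
    (hσ_pointed : ∀ u ∈ σ, -u ∈ σ → u = 0)
    (hσ_full : Submodule.span ℝ (σ : Set (ToricMather.DualSpace M)) = ⊤)
    (a : Module.Dual ℤ M) (ha : a ≠ 0) (haσ : (1 : ℝ) ⊗ₜ[ℤ] a ∈ σ) :
    ∃ d : ℤ,
      ToricMather.IsMatherDiscrepancy (ToricMather.CoordRing (ToricMather.dualMonoid σ))
        (Module.finrank ℤ M) (ToricMather.toricValuation (ToricMather.dualMonoid σ) a) d ∧
      IsLeast {s : ℤ | ∃ x : Fin (Module.finrank ℤ M) → M,
          (∀ i, x i ∈ ToricMather.dualMonoid σ) ∧ LinearIndependent ℤ x ∧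
          s = ∑ i, a (x i) - (ToricMather.divisibilityIndex a : ℤ)} d := by
  have hS := ToricMather.exists_add_mem_dualMonoid hσ_rat hσ_pointed
  obtain ⟨hk, b, hab, hb⟩ := ToricMather.divisibilityIndex_spec ha
  -- From here `a` is `k • b` with `b` primitive; the discrepancy and every competing sum are `k`
  -- times their counterparts for `b`.
  generalize ToricMather.divisibilityIndex a = k at hk hab ⊢
  subst hab
  have hk' : (0 : ℤ) < k := by exact_mod_cast hk
  have hbS : ∀ m ∈ ToricMather.dualMonoid σ, 0 ≤ b m := fun m hm => by
    have h1 := hm _ haσ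
    rw [ToricMather.realPairing_tmul, one_mul, LinearMap.smul_apply, nsmul_eq_mul] at h1
    have h2 : (0 : ℤ) ≤ k * b m := by exact_mod_cast h1
    exact (mul_nonneg_iff_of_pos_left hk').1 h2
  obtain ⟨d, hd⟩ := ToricMather.exists_isLeast_sum_sub_one hS hbS hb
  have hsum : ∀ x : Fin (Module.finrank ℤ M) → M,
      ∑ i, (k • b) (x i) - (k : ℤ) = k * (∑ i, b (x i) - 1) := fun x => by
    simp [mul_sub, Finset.mul_sum]
  refine ⟨k * d, ⟨?_, fun W y q hW => ?_⟩, ?_, ?_⟩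
  · obtain ⟨W, y, hW⟩ := ToricMather.exists_represents_toricValuation hS hbS hb hk
    exact ⟨W, y, k, hW⟩
  · have hiff := hW.ordMatherEq_iff hS hb hk hd
    refine ⟨⟨d, (hiff d).2 rfl⟩, fun l hl => ?_⟩
    rw [(hiff l).1 hl, hW.eq_of_eq_nsmul hS hb hk]
  · obtain ⟨x, hxS, hx, hdx⟩ := hd.1
    exact ⟨x, hxS, hx, by rw [hsum, hdx]⟩
  · rintro _ ⟨x, hxS, hx, rfl⟩
    rw [hsum]
    exact mul_le_mul_of_nonneg_left (hd.2 ⟨x, hxS, hx, rfl⟩) hk'.le
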